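/- Work in $L^2(\mathbb R)$ with position and momentum operators $\hat x,\hat p$, $[\hat x,\hat p]=i$, vacuum $|0\rangle$ (wave function $\pi^{-1/4}e^{-x^2/2}$) and displacement operators $D(\alpha,\beta)=\exp(i\sqrt2\,\beta\hat x-i\sqrt2\,\alpha\hat p)$. Let $$\Delta(x,y;\theta)=\Big[\frac{1+i\cot\theta}{2\pi}\Big]^{1/2}\exp\Big[-\frac{i(x^2+y^2)\cot\theta}{2}+\frac{ixy}{\sin\theta}\Big]$$ (principal square root) be the kernel of the fractional Fourier transform, read as $\delta(x-y)$ if $\sin\theta=0$, $\cos\theta=1$ and as $\delta(x+y)$ if $\sin\theta=0$, $\cos\theta=-1$. For real $\theta_1,\theta_2$ with $\cos(\theta_1-\theta_2)\neq0$ and real $\alpha,\beta$ let $$U(\alpha,\beta;\theta_1,\theta_2)=|\cos(\theta_1-\theta_2)|^{1/2}\int d\alpha'\,d\beta'\,\Delta(\beta,\alpha';\theta_2)\,\Delta(\alpha,-\beta';\theta_1)\,D(\alpha',\beta')$$ (integral in the weak sense, between Schwartz functions), and let $|\alpha,\beta;\theta_1,\theta_2\rangle=U(\alpha,\beta;\theta_1,\theta_2)|0\rangle$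 be the bifractional coherent states. Put $$w=w(\theta_1,\theta_2)=\frac{\alpha e_2+i\beta e_1}{\cos(\theta_1-\theta_2)},\qquad e_j=ie^{-i\theta_j},$$ so that $(\alpha,\beta)\mapsto w$ is a linear bijection $\mathbb R^2\to\mathbb C$, and write $|w(\theta_1,\theta_2)\rangle=|\alpha,\beta;\theta_1,\theta_2\rangle$. Then: (1) [Analyticity] With $E(w|w^*)=\tfrac12|w|^2-\tfrac12 b\,(w^*)^2$ and $b=\tfrac14\left(e^{-2i\theta_1}-e^{-2i\theta_2}\right)$, the vector $\exp(E(w|w^*))\,|w(\theta_1,\theta_2)\rangle$ depends only on $w$ and not on $w^*$; that is, it is an entire $L^2(\mathbb R)$-valued function of $w\in\mathbb C$. (2) [Resolution of the identity] In the sense of absolutely convergent weak integrals, $$\frac{1}{\pi\,|\cos(\theta_1-\theta_2)|}\int_{\mathbb R^2}d\alpha\,d\beta\;|\alpha,\beta;\theta_1,\theta_2\rangle\langle\alpha,\beta;\theta_1,\theta_2|=\mathbf 1,$$ and, with $d^2w=d(\mathrm{Re}\,w)\,d(\mathrm{Im}\,w)$, $$\int_{\mathbb C}\frac{d^2w}{\pi}\;|w(\theta_1,\theta_2)\rangle\langle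 w(\theta_1,\theta_2)|=\mathbf 1.$$ -/

import Mathlib

open MeasureTheory
open scoped SchwartzMap ComplexConjugate ENNReal

noncomputable section

namespace Bifractional

/-! ### The Hilbert space, displacement operators and the vacuum -/

/-- The Hilbert space `L²(ℝ)` of the harmonic oscillator (position representation, `ħ = 1`). -/
abbrev HSpace : Type := Lp ℂ 2 (volume : Measure ℝ)

/-- The position operator `(x̂ f)(x) = x f(x)`. -/
def posOp (f : ℝ → ℂ) (x : ℝ) : ℂ := (x : ℂ) * f x

/-- The momentum operator `(p̂ f)(x) = - i f'(x)`. -/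
def momOp (f : ℝ → ℂ) (x : ℝ) : ℂ := -Complex.I * deriv f x

/-- The action of `D(α, β) = exp (i √2 β x̂ - i √2 α p̂)` on wave functions:
`(D(α, β) f)(x) = exp (i √2 β x - i α β) f (x - √2 α)`.
See `hasDerivAt_dispFun` for the generator, `dispFun_dispFun` for the composition law. -/
def dispFun (α β : ℝ) (f : ℝ → ℂ) (x : ℝ) : ℂ :=
  Complex.exp (Complex.I * ((√2 * β * x - α * β : ℝ) : ℂ)) * f (x - √2 * α)

theorem dispFun_zero (f : ℝ → ℂ) : dispFun 0 0 f = f := by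
  funext x
  simp [dispFun]

theorem dispFun_dispFun (α β α' β' : ℝ) (f : ℝ → ℂ) (x : ℝ) :
    dispFun α β (dispFun α' β' f) x =
      Complex.exp (Complex.I * ((β * α' - α * β' : ℝ) : ℂ)) *
        dispFun (α + α') (β + β') f x := by
  have h2 : √2 * √2 = (2 : ℝ) := Real.mul_self_sqrt (by norm_num)
  have h3 : x - √2 * α - √2 * α' = x - √2 * (α + α') := by ring
  simp only [dispFun, ← mul_assoc, ← Complex.exp_add, h3]
  congr 2
  rw [← mul_add, ← mul_add, ← Complex.ofReal_add, ← Complex.ofReal_add]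
  congr 2
  linear_combination (-(β' * α)) * h2

/-- `t ↦ D(t α, t β)` is generated by `i √2 β x̂ - i √2 α p̂`, so that `D(α, β)` is indeed the
exponential of this operator. -/
theorem hasDerivAt_dispFun (α β : ℝ) (f : ℝ → ℂ) (hf : Differentiable ℝ f) (t x : ℝ) :
    HasDerivAt (fun s : ℝ => dispFun (s * α) (s * β) f x)
      (Complex.I * √2 * β * posOp (dispFun (t * α) (t * β) f) x
        - Complex.I * √2 * α * momOp (dispFun (t * α) (t * β) f) x) t := by
  have h2 : (√2 : ℂ) * √2 = 2 := by
    rw [← Complex.ofReal_mul, Real.mul_self_sqrt (by norm_num)]; norm_num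
  have hI : Complex.I * Complex.I = -1 := Complex.I_mul_I
  have hfx := (hf (x - √2 * (t * α))).hasDerivAt
  have e1 : HasDerivAt (fun s : ℝ => √2 * (s * β) * x - s * α * (s * β))
      (√2 * β * x - 2 * t * α * β) t := by
    have := (((hasDerivAt_id t).mul_const β).const_mul √2).mul_const x
    have h' := ((hasDerivAt_id t).mul_const α).mul ((hasDerivAt_id t).mul_const β)
    refine (this.sub h').congr_deriv ?_
    simp only [id]
    ring
  have e2 : HasDerivAt (fun s : ℝ => x - √2 * (s * α)) (-(√2 * α)) t := by
    have := (((hasDerivAt_id t).mul_const α).const_mul √2).const_sub x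
    simpa using this
  have e3 := (e1.ofReal_comp.const_mul Complex.I).cexp
  have e4 := hfx.scomp t e2
  have e5 := e3.mul e4
  have d1 : HasDerivAt (fun y : ℝ => √2 * (t * β) * y - t * α * (t * β)) (√2 * (t * β)) x := by
    simpa using ((hasDerivAt_id x).const_mul (√2 * (t * β))).sub_const (t * α * (t * β))
  have d2 : HasDerivAt (fun y : ℝ => y - √2 * (t * α)) 1 x :=
    (hasDerivAt_id x).sub_const _
  have d3 := (d1.ofReal_comp.const_mul Complex.I).cexp.mul (hfx.scomp x d2)
  have d4 : deriv (dispFun (t * α) (t * β) f) x = _ := d3.deriv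
  simp only [momOp, posOp, d4]
  refine e5.congr_deriv ?_
  simp only [dispFun, Function.comp, Complex.real_smul]
  push_cast
  generalize Complex.exp _ = E
  generalize f _ = F
  generalize deriv f _ = G
  linear_combination (-(√2 * α * E * G : ℂ) - E * F * (Complex.I * t * α * β) * √2 * √2) * hI
    + (E * F * Complex.I * t * α * β) * h2

theorem memLp_dispFun (α β : ℝ) {f : ℝ → ℂ} (hf : MemLp f 2 volume) :
    MemLp (dispFun α β f) 2 volume := by
  have h1 : MemLp (fun x => f (x - √2 * α)) 2 volume :=
    hf.comp_measurePreserving (measurePreserving_sub_right volume (√2 * α))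
  refine h1.of_le (AEStronglyMeasurable.mul ?_ h1.1) (.of_forall fun x => ?_)
  · exact Continuous.aestronglyMeasurable (by fun_prop)
  · rw [dispFun, norm_mul, mul_comm Complex.I, Complex.norm_exp_ofReal_mul_I, one_mul]

theorem dispFun_congr (α β : ℝ) {f g : ℝ → ℂ} (h : f =ᵐ[volume] g) :
    dispFun α β f =ᵐ[volume] dispFun α β g := by
  have := (measurePreserving_sub_right (volume : Measure ℝ)
    (√2 * α)).quasiMeasurePreserving.ae_eq_comp h
  filter_upwards [this] with x hx
  simp only [Function.comp] at hx
  simp only [dispFun, hx]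

theorem norm_toLp_dispFun (α β : ℝ) (f : HSpace) :
    ‖(memLp_dispFun α β (Lp.memLp f)).toLp‖ = ‖f‖ := by
  rw [Lp.norm_toLp, Lp.norm_def]
  congr 1
  rw [← eLpNorm_comp_measurePreserving (Lp.aestronglyMeasurable f)
    (measurePreserving_sub_right (volume : Measure ℝ) (√2 * α))]
  refine eLpNorm_congr_norm_ae (.of_forall fun x => ?_)
  rw [dispFun, norm_mul, mul_comm Complex.I, Complex.norm_exp_ofReal_mul_I, one_mul]
  rfl

/-- The displacement operator `D(α, β)`, a unitary operator on `L²(ℝ)`. -/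
def displacement (α β : ℝ) : HSpace ≃ₗᵢ[ℂ] HSpace where
  toFun f := (memLp_dispFun α β (Lp.memLp f)).toLp
  invFun f := (memLp_dispFun (-α) (-β) (Lp.memLp f)).toLp
  map_add' f g := by
    rw [← MemLp.toLp_add, MemLp.toLp_eq_toLp_iff]
    refine (dispFun_congr α β (Lp.coeFn_add f g)).trans (.of_forall fun x => ?_)
    simp [dispFun, mul_add]
  map_smul' c f := by
    rw [RingHom.id_apply, ← MemLp.toLp_const_smul, MemLp.toLp_eq_toLp_iff]
    refine (dispFun_congr α β (Lp.coeFn_smul c f)).trans (.of_forall fun x => ?_)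
    simp [dispFun, mul_left_comm]
  left_inv f := by
    refine Lp.ext ((MemLp.coeFn_toLp _).trans ?_)
    refine (dispFun_congr _ _ (MemLp.coeFn_toLp _)).trans (.of_forall fun x => ?_)
    rw [dispFun_dispFun]
    simp only [neg_add_cancel, dispFun_zero]
    simp [mul_comm]
  right_inv f := by
    refine Lp.ext ((MemLp.coeFn_toLp _).trans ?_)
    refine (dispFun_congr _ _ (MemLp.coeFn_toLp _)).trans (.of_forall fun x => ?_)
    rw [dispFun_dispFun]
    simp only [add_neg_cancel, dispFun_zero]
    simp [mul_comm]
  norm_map' f := norm_toLp_dispFun α β f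

theorem poly_mul_gaussian_le (p : Polynomial ℤ) : ∃ C : ℝ, ∀ x : ℝ,
    |Polynomial.aeval x p| * Real.exp (-(x ^ 2 / 2)) ≤ C := by
  induction p using Polynomial.induction_on' with
  | add p q hp hq =>
    obtain ⟨C, hC⟩ := hp
    obtain ⟨D, hD⟩ := hq
    refine ⟨C + D, fun x => ?_⟩
    rw [map_add]
    calc _ ≤ (|Polynomial.aeval x p| + |Polynomial.aeval x q|) * Real.exp (-(x ^ 2 / 2)) := by
          gcongr
          exact abs_add_le _ _
      _ ≤ _ := by rw [add_mul]; exact add_le_add (hC x) (hD x)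
  | monomial m a =>
    refine ⟨|(a : ℝ)| * (1 + 2 ^ m * m.factorial), fun x => ?_⟩
    rw [Polynomial.aeval_monomial, eq_intCast, abs_mul, abs_pow, mul_assoc]
    refine mul_le_mul_of_nonneg_left ?_ (abs_nonneg _)
    have h1 : |x| ^ m ≤ 1 + (x ^ 2) ^ m := by
      rw [← sq_abs x, ← pow_mul, mul_comm 2 m, pow_mul]
      nlinarith [sq_nonneg (|x| ^ m - 1)]
    have h2 : (x ^ 2 / 2) ^ m ≤ m.factorial * Real.exp (x ^ 2 / 2) := by
      have := Real.pow_div_factorial_le_exp (x := x ^ 2 / 2) (by positivity) m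
      rwa [div_le_iff₀ (by positivity), mul_comm] at this
    have h3 : (x ^ 2) ^ m = 2 ^ m * (x ^ 2 / 2) ^ m := by
      rw [← mul_pow]; congr 1; ring
    have h4 : (1 : ℝ) ≤ Real.exp (x ^ 2 / 2) := Real.one_le_exp (by positivity)
    rw [Real.exp_neg, ← div_eq_mul_inv, div_le_iff₀ (Real.exp_pos _)]
    calc |x| ^ m ≤ 1 + (x ^ 2) ^ m := h1
      _ ≤ Real.exp (x ^ 2 / 2) + 2 ^ m * (m.factorial * Real.exp (x ^ 2 / 2)) := by
          rw [h3]; gcongr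
      _ = _ := by ring

theorem gaussian_decay (k n : ℕ) : ∃ C : ℝ, ∀ x : ℝ,
    ‖x‖ ^ k * ‖iteratedFDeriv ℝ n (fun y : ℝ => Real.exp (-(y ^ 2 / 2))) x‖ ≤ C := by
  obtain ⟨C, hC⟩ := poly_mul_gaussian_le (Polynomial.X ^ k * Polynomial.hermite n)
  refine ⟨C, fun x => le_trans (le_of_eq ?_) (hC x)⟩
  rw [norm_iteratedFDeriv_eq_norm_iteratedDeriv, iteratedDeriv_eq_iterate,
    Polynomial.deriv_gaussian_eq_hermite_mul_gaussian]
  simp [abs_mul, mul_assoc]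

/-- The vacuum `|0⟩`, i.e. the wave function `π^(-1/4) exp (-x²/2)`. -/
def vacuum : 𝓢(ℝ, ℂ) where
  toFun x := ((Real.pi ^ (-(1 / 4) : ℝ) * Real.exp (-(x ^ 2 / 2)) : ℝ) : ℂ)
  smooth' := by
    have hg : ContDiff ℝ (⊤ : ℕ∞)
        (fun x : ℝ => Real.pi ^ (-(1 / 4) : ℝ) * Real.exp (-(x ^ 2 / 2))) := by fun_prop
    exact Complex.ofRealCLM.contDiff.comp hg
  decay' k n := by
    obtain ⟨C, hC⟩ := gaussian_decay k n
    have hg : ContDiff ℝ n (fun y : ℝ => Real.exp (-(y ^ 2 / 2))) := by fun_prop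
    have hg2 : ContDiff ℝ n ((Real.pi ^ (-(1 / 4) : ℝ)) •
        fun y : ℝ => Real.exp (-(y ^ 2 / 2))) := by
      have h := hg.const_smul (Real.pi ^ (-(1 / 4) : ℝ))
      exact h
    refine ⟨|Real.pi ^ (-(1 / 4) : ℝ)| * C, fun x => ?_⟩
    have h1 := Complex.ofRealLI.norm_iteratedFDeriv_comp_left (n := n) (i := n) (x := x)
      (f := (Real.pi ^ (-(1 / 4) : ℝ)) • fun y : ℝ => Real.exp (-(y ^ 2 / 2)))
      hg2.contDiffAt le_rfl
    have h2 := iteratedFDeriv_const_smul_apply (𝕜 := ℝ) (i := n) (x := x)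
      (a := Real.pi ^ (-(1 / 4) : ℝ)) (f := fun y : ℝ => Real.exp (-(y ^ 2 / 2)))
      hg.contDiffAt
    rw [h2, norm_smul, Real.norm_eq_abs] at h1
    calc _ = ‖x‖ ^ k * (|Real.pi ^ (-(1 / 4) : ℝ)| *
          ‖iteratedFDeriv ℝ n (fun y : ℝ => Real.exp (-(y ^ 2 / 2))) x‖) := by
          rw [← h1]; rfl
      _ ≤ _ := by
          rw [mul_left_comm]
          exact mul_le_mul_of_nonneg_left (hC x) (abs_nonneg _)

theorem vacuum_apply (x : ℝ) :
    vacuum x = ((Real.pi ^ (-(1 / 4) : ℝ) * Real.exp (-(x ^ 2 / 2)) : ℝ) : ℂ) := rfl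

/-- The vacuum is annihilated by `a = (x̂ + i p̂) / √2`. -/
theorem annihilation_vacuum (x : ℝ) :
    posOp vacuum x + Complex.I * momOp vacuum x = 0 := by
  have h : HasDerivAt vacuum
      ((Real.pi ^ (-(1 / 4) : ℝ) * (Real.exp (-(x ^ 2 / 2)) * (-x)) : ℝ) : ℂ) x := by
    refine HasDerivAt.ofReal_comp (HasDerivAt.const_mul _ (HasDerivAt.exp ?_))
    refine ((hasDerivAt_pow 2 x).div_const 2).neg.congr_deriv ?_
    simp
  rw [posOp, momOp, h.deriv, vacuum_apply]
  push_cast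
  linear_combination (-(Real.pi ^ (-(1 / 4) : ℝ) : ℝ) * -(x : ℂ) *
    Complex.exp (-((x : ℂ) ^ 2 / 2))) * Complex.I_mul_I

theorem norm_vacuum : ‖vacuum.toLp 2 (volume : Measure ℝ)‖ = 1 := by
  have h1 : inner ℂ (vacuum.toLp 2 (volume : Measure ℝ) : HSpace)
      (vacuum.toLp 2 (volume : Measure ℝ)) = (1 : ℂ) := by
    rw [L2.inner_def]
    have : ∀ᵐ x ∂(volume : Measure ℝ),
        inner ℂ ((vacuum.toLp 2 (volume : Measure ℝ) : HSpace) x)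
          ((vacuum.toLp 2 (volume : Measure ℝ) : HSpace) x) =
        ((Real.pi ^ (-(1 / 2) : ℝ) * Real.exp (-1 * x ^ 2) : ℝ) : ℂ) := by
      filter_upwards [vacuum.coeFn_toLp 2 (volume : Measure ℝ)] with x hx
      rw [hx, vacuum_apply, RCLike.inner_apply, Complex.conj_ofReal, ← Complex.ofReal_mul]
      congr 1
      rw [mul_mul_mul_comm, ← Real.rpow_add Real.pi_pos, ← Real.exp_add]
      congr 2 <;> ring
    rw [integral_congr_ae this, integral_complex_ofReal, integral_const_mul, integral_gaussian,
      div_one, Real.sqrt_eq_rpow, ← Real.rpow_add Real.pi_pos]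
    norm_num
  have h2 := inner_self_eq_norm_sq_to_K (𝕜 := ℂ) (vacuum.toLp 2 (volume : Measure ℝ) : HSpace)
  rw [h1] at h2
  have h3 : ‖vacuum.toLp 2 (volume : Measure ℝ)‖ ^ 2 = 1 := by
    have h4 : ((‖vacuum.toLp 2 (volume : Measure ℝ)‖ ^ 2 : ℝ) : ℂ) = (1 : ℝ) := by
      rw [Complex.ofReal_pow, Complex.ofReal_one]
      exact h2.symm
    exact Complex.ofReal_injective h4
  exact (pow_eq_one_iff_of_nonneg (norm_nonneg _) two_ne_zero).1 h3

/-! ### Fractional Fourier transform and bifractional displacement operators -/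

/-- The kernel `Δ(x, y; θ)` of the fractional Fourier transform (for `sin θ ≠ 0`), with the
principal branch of the square root (the radicand has positive real part). -/
def fracKernel (x y θ : ℝ) : ℂ :=
  ((1 + Complex.I * (Real.cot θ : ℂ)) / (2 * (Real.pi : ℂ))) ^ (1 / 2 : ℂ) *
    Complex.exp (-Complex.I * ((x : ℂ) ^ 2 + (y : ℂ) ^ 2) * (Real.cot θ : ℂ) / 2
      + Complex.I * (x : ℂ) * (y : ℂ) / (Real.sin θ : ℂ))

/-- `∫ dy Δ(x, y; θ) f(y)`. If `sin θ = 0` the kernel is the delta function `δ(x - y)`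
(when `cos θ = 1`) or `δ(x + y)` (when `cos θ = -1`). -/
def fracTransform (x θ : ℝ) (f : ℝ → ℂ) : ℂ :=
  if Real.sin θ = 0 then f (Real.cos θ * x) else ∫ y : ℝ, fracKernel x y θ * f y

/-- The matrix element `⟨φ| U(α, β; θ₁, θ₂) |ψ⟩`, i.e.
`|cos (θ₁ - θ₂)|^(1/2) ∫ dα' dβ' Δ(β, α'; θ₂) Δ(α, -β'; θ₁) ⟨φ| D(α', β') |ψ⟩`,
for Schwartz functions `φ`, `ψ` (for which `⟨φ| D(α', β') |ψ⟩` is a Schwartz function of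
`α', β'`, so the integral converges absolutely). In the inner integral the variable is `b = -β'`. -/
def bifracForm (α β θ₁ θ₂ : ℝ) (φ ψ : 𝓢(ℝ, ℂ)) : ℂ :=
  ((√|Real.cos (θ₁ - θ₂)| : ℝ) : ℂ) *
    fracTransform β θ₂ fun a => fracTransform α θ₁ fun b =>
      inner ℂ (φ.toLp 2 (volume : Measure ℝ) : HSpace)
        (displacement a (-b) (ψ.toLp 2 (volume : Measure ℝ)))

/-- The vector `χ` of `L²(ℝ)` is the weak integral
`U(α, β; θ₁, θ₂) ψ = |cos (θ₁ - θ₂)|^(1/2) ∫ dα' dβ' Δ(β, α'; θ₂) Δ(α, -β'; θ₁) D(α', β') ψ`. -/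
def IsBifracImage (α β θ₁ θ₂ : ℝ) (ψ : 𝓢(ℝ, ℂ)) (χ : HSpace) : Prop :=
  ∀ φ : 𝓢(ℝ, ℂ), inner ℂ (φ.toLp 2 (volume : Measure ℝ) : HSpace) χ =
    bifracForm α β θ₁ θ₂ φ ψ

theorem IsBifracImage.unique {α β θ₁ θ₂ : ℝ} {ψ : 𝓢(ℝ, ℂ)} {χ χ' : HSpace}
    (h : IsBifracImage α β θ₁ θ₂ ψ χ) (h' : IsBifracImage α β θ₁ θ₂ ψ χ') : χ = χ' := by
  have hd : DenseRange (SchwartzMap.toLpCLM ℝ ℂ 2 (volume : Measure ℝ)) :=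
    SchwartzMap.denseRange_toLpCLM (by norm_num)
  have key : (fun v : HSpace => inner ℂ v χ) = fun v : HSpace => inner ℂ v χ' := by
    refine hd.equalizer (by fun_prop) (by fun_prop) ?_
    funext φ
    exact (h φ).trans (h' φ).symm
  exact ext_inner_left ℂ fun v => congrFun key v

open Classical in
/-- The bifractional displacement operator `U(α, β; θ₁, θ₂)` on its core of Schwartz functions:
`U ψ` is the weak integral in `IsBifracImage`, which is unique by `IsBifracImage.unique`; the
value `0` is only there to make the definition total. -/
def bifracOp (α β θ₁ θ₂ : ℝ) (ψ : 𝓢(ℝ, ℂ)) : HSpace :=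
  if h : ∃ χ : HSpace, IsBifracImage α β θ₁ θ₂ ψ χ then h.choose else 0

/-! ### Bifractional coherent states -/

/-- The bifractional coherent state `|α, β; θ₁, θ₂⟩ = U(α, β; θ₁, θ₂)|0⟩`. -/
def ket (α β θ₁ θ₂ : ℝ) : HSpace := bifracOp α β θ₁ θ₂ vacuum

/-- The phase `e = i exp (-i θ)`; `e₁` and `e₂` are its values at `θ₁` and `θ₂`. -/
def phase (θ : ℝ) : ℂ := Complex.I * Complex.exp (-Complex.I * (θ : ℂ))

/-- `w(θ₁, θ₂) = (α e₂ + i β e₁) / cos (θ₁ - θ₂)`. -/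
def wParam (α β θ₁ θ₂ : ℝ) : ℂ :=
  ((α : ℂ) * phase θ₂ + Complex.I * (β : ℂ) * phase θ₁) / (Real.cos (θ₁ - θ₂) : ℂ)

/-- The state `|w(θ₁, θ₂)⟩`, i.e. `|α, β; θ₁, θ₂⟩` for the `α`, `β` with
`wParam α β θ₁ θ₂ = w`, see `wState_wParam` and `wParam_coords`. -/
def wState (θ₁ θ₂ : ℝ) (w : ℂ) : HSpace :=
  ket (conj (phase θ₁) * w).re (conj (phase θ₂) * w).im θ₁ θ₂

theorem phase_eq (θ : ℝ) : phase θ = (⟨Real.sin θ, Real.cos θ⟩ : ℂ) := by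
  have : -Complex.I * (θ : ℂ) = ((-θ : ℝ) : ℂ) * Complex.I := by push_cast; ring
  rw [phase, this]
  apply Complex.ext <;> simp [Complex.exp_ofReal_mul_I_re, Complex.exp_ofReal_mul_I_im,
    -Complex.ofReal_neg]

theorem wParam_eq (α β θ₁ θ₂ : ℝ) : wParam α β θ₁ θ₂ =
    ⟨(α * Real.sin θ₂ - β * Real.cos θ₁) / Real.cos (θ₁ - θ₂),
      (α * Real.cos θ₂ + β * Real.sin θ₁) / Real.cos (θ₁ - θ₂)⟩ := by
  rw [wParam, phase_eq, phase_eq]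
  apply Complex.ext
  · rw [Complex.div_ofReal_re]; simp [sub_eq_add_neg]
  · rw [Complex.div_ofReal_im]; simp

theorem wState_wParam (α β θ₁ θ₂ : ℝ) (h : Real.cos (θ₁ - θ₂) ≠ 0) :
    wState θ₁ θ₂ (wParam α β θ₁ θ₂) = ket α β θ₁ θ₂ := by
  rw [wState, wParam_eq, phase_eq, phase_eq]
  simp only [Complex.mul_re, Complex.mul_im, Complex.conj_re, Complex.conj_im]
  congr 1
  · field_simp
    rw [Real.cos_sub]; ring
  · field_simp
    rw [Real.cos_sub]; ring

theorem wParam_coords (θ₁ θ₂ : ℝ) (h : Real.cos (θ₁ - θ₂) ≠ 0) (w : ℂ) :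
    wParam (conj (phase θ₁) * w).re (conj (phase θ₂) * w).im θ₁ θ₂ = w := by
  rw [wParam_eq, phase_eq, phase_eq]
  simp only [Complex.mul_re, Complex.mul_im, Complex.conj_re, Complex.conj_im]
  apply Complex.ext
  · simp only
    field_simp
    rw [Real.cos_sub]; ring
  · simp only
    field_simp
    rw [Real.cos_sub]; ring

/-- `b = (exp (-2 i θ₁) - exp (-2 i θ₂)) / 4`. -/
def bParam (θ₁ θ₂ : ℝ) : ℂ :=
  (1 / 4) * (Complex.exp (-2 * Complex.I * (θ₁ : ℂ)) - Complex.exp (-2 * Complex.I * (θ₂ : ℂ)))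

/-- `E(w | w*) = |w|² / 2 - b (w*)² / 2`. -/
def expoE (θ₁ θ₂ : ℝ) (w : ℂ) : ℂ :=
  (1 / 2) * ((‖w‖ ^ 2 : ℝ) : ℂ) - (1 / 2) * bParam θ₁ θ₂ * (conj w) ^ 2

/-- The operator identity `c ∫ |v x⟩⟨v x| dμ(x) = 1`, as an absolutely convergent weak operator
integral. -/
def ResolvesIdentity {X : Type*} [MeasurableSpace X] (μ : Measure X) (c : ℝ)
    (v : X → HSpace) : Prop :=
  ∀ f g : HSpace, Integrable (fun x => inner ℂ f (v x) * inner ℂ (v x) g) μ ∧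
    (c : ℂ) * ∫ x, inner ℂ f (v x) * inner ℂ (v x) g ∂μ = inner ℂ f g

end Bifractional

end

noncomputable section

namespace Bifractional

/-! ### Plancherel's theorem and displaced windows -/

/-! Everything rests on a closed form for the bifractional coherent state (`ket_eq`): up to the
scalar √|cos(θ₁ - θ₂)| exp(-(α² + β²)/2) it is the squeezed vector exp(τ a†²/2 + μ a†)|0⟩. Here τ
depends only on the angles, |τ|² = 1 - cos²(θ₁ - θ₂) < 1, and μ is real-linear in (α, β).

To obtain it, expand ⟨φ|D(a, -b)|0⟩ over the ordinary coherent states D(p)|0⟩, which resolve the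
identity. The overlaps ⟨0|D(p)* D(a, -b)|0⟩ are Gaussian in a and b, and the fractional Fourier
transform maps Gaussians exp(-y²/2 + ky) to Gaussians of the same kind (`fracTransform_gaussian`).
Fubini applies because ⟨φ|D(p)|0⟩ is integrable in p for Schwartz φ. The transformed overlap is the
overlap of D(p)|0⟩ with a squeezed vector, so the same resolution, read backwards, identifies the
state (`isBifracImage_vacuum`).

Analyticity: in terms of w, μ is a constant complex multiple of w, and E equals (α² + β²)/2 plus the
holomorphic term τw²/4. Hence exp(E) cancels the only non-holomorphic factor, and the squeezed
vector is entire in μ as an element of L² (`differentiable_toLp_squeezed`).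

Resolution of the identity: after a linear change of variables the state is a scalar of modulus
√|cos(θ₁ - θ₂)| times a displaced copy of the fixed vector s = exp(τ a†²/2)|0⟩
(`ket_eq_displacement`). The orthogonality relation ∫|⟨D(u,v)s, f⟩|² = π‖s‖²‖f‖²
(`lintegral_inner_displacement`) and polarization finish the proof, with ‖s‖² = 1/|cos(θ₁ - θ₂)|. -/

theorem eLpNorm_two_sq {X : Type*} [MeasurableSpace X] (μ : Measure X) (f : X → ℂ) :
    eLpNorm f 2 μ ^ 2 = ∫⁻ x, ‖f x‖ₑ ^ 2 ∂μ := by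
  have := eLpNorm_nnreal_pow_eq_lintegral (f := f) (μ := μ) (p := 2) two_ne_zero
  simpa only [NNReal.coe_ofNat, ENNReal.rpow_ofNat, ENNReal.coe_ofNat] using this

open FourierTransform in
/-- Plancherel's theorem for functions in `L¹ ∩ L²`. -/
theorem lintegral_enorm_fourier_sq {h : ℝ → ℂ} (h1 : Integrable h) (h2 : MemLp h 2) :
    ∫⁻ ξ, ‖𝓕 h ξ‖ₑ ^ 2 = ∫⁻ x, ‖h x‖ₑ ^ 2 := by
  have hc : Continuous (𝓕 h) := VectorFourier.fourierIntegral_continuous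
    Real.continuous_fourierChar continuous_inner h1
  -- The Fourier transform on L² agrees with the Fourier integral: both give the same pairing with
  -- every test function, once the transform is moved onto the test function.
  have key : (𝓕 (h2.toLp h) : HSpace) =ᵐ[volume] 𝓕 h := by
    refine ae_eq_of_integral_contDiff_smul_eq ((Lp.memLp _).locallyIntegrable (by norm_num))
      hc.locallyIntegrable fun g hg hgc => ?_
    have hg₁ : HasCompactSupport (Complex.ofRealCLM ∘ g) := hgc.comp_left rfl
    have hg₂ : ContDiff ℝ (⊤ : ℕ∞) (Complex.ofRealCLM ∘ g) := by fun_prop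
    set G : 𝓢(ℝ, ℂ) := hg₁.toSchwartzMap hg₂ with hG
    have e1 : ∫ x, g x • (𝓕 (h2.toLp h) : HSpace) x = ∫ x, 𝓕 G x • h x := by
      calc _ = ((𝓕 (h2.toLp h) : HSpace) : 𝓢'(ℝ, ℂ)) G := by
            rw [Lp.toTemperedDistribution_apply]; rfl
        _ = ((h2.toLp h : HSpace) : 𝓢'(ℝ, ℂ)) (𝓕 G) := by
            rw [← Lp.fourier_toTemperedDistribution_eq, TemperedDistribution.fourier_apply]
        _ = _ := by
            rw [Lp.toTemperedDistribution_apply]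
            refine integral_congr_ae ?_
            filter_upwards [h2.coeFn_toLp] with x hx
            rw [hx]
    have e2 := VectorFourier.integral_fourierIntegral_smul_eq_flip (L := innerₗ ℝ)
      Real.continuous_fourierChar continuous_inner G.integrable h1 (μ := volume) (ν := volume)
    rw [e1, SchwartzMap.fourier_coe]
    refine Eq.trans e2 ?_
    rw [flip_innerₗ]
    rfl
  have e3 : eLpNorm (𝓕 h) 2 volume = eLpNorm h 2 volume := by
    rw [← eLpNorm_congr_ae key, ← eLpNorm_congr_ae h2.coeFn_toLp, ← Lp.enorm_def, ← Lp.enorm_def]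
    have := Lp.norm_fourier_eq (h2.toLp h)
    rw [← ofReal_norm, ← ofReal_norm, this]
  rw [← eLpNorm_two_sq, ← eLpNorm_two_sq, e3]

theorem lintegral_comp_mul_left (a : ℝ) (ha : 0 < a) (F : ℝ → ℝ≥0∞) (hF : Measurable F) :
    ∫⁻ x, F (a * x) = ENNReal.ofReal a⁻¹ * ∫⁻ x, F x := by
  have h := lintegral_map (μ := (volume : Measure ℝ)) hF (measurable_const_mul a)
  rw [Real.map_volume_mul_left ha.ne', lintegral_smul_measure, abs_of_pos (inv_pos.2 ha)] at h
  exact h.symm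

theorem inner_toLp {s : ℝ → ℂ} (hs : MemLp s 2) (f : HSpace) :
    inner ℂ (hs.toLp : HSpace) f = ∫ x, f x * conj (s x) := by
  rw [L2.inner_def]
  refine integral_congr_ae ?_
  filter_upwards [hs.coeFn_toLp] with x hx
  rw [hx, RCLike.inner_apply]

theorem displacement_toLp {s : ℝ → ℂ} (hs : MemLp s 2) (u v : ℝ) :
    displacement u v hs.toLp = (memLp_dispFun u v hs).toLp :=
  (MemLp.toLp_eq_toLp_iff (memLp_dispFun u v (Lp.memLp _)) _).2
    (dispFun_congr u v hs.coeFn_toLp)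

theorem measurable_inner_displacement {s : ℝ → ℂ} (hs : MemLp s 2) (hsc : Continuous s)
    (f : HSpace) :
    StronglyMeasurable fun p : ℝ × ℝ => inner ℂ (displacement p.1 p.2 hs.toLp) f := by
  simp only [displacement_toLp, inner_toLp]
  refine StronglyMeasurable.integral_prod_right (f := fun (p : ℝ × ℝ) x =>
    f x * conj (dispFun p.1 p.2 s x)) ?_
  refine ((Lp.stronglyMeasurable f).comp_measurable measurable_snd).mul
    (Continuous.stronglyMeasurable ?_)
  simp only [dispFun]
  fun_prop

open FourierTransform in
-- For fixed u the matrix element is, up to a phase, a short-time Fourier transform with window s.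
-- The phase √2 v x corresponds to the frequency √2 v / (2π) = v / (√2 π).
theorem inner_displacement_eq_fourier {s : ℝ → ℂ} (hs : MemLp s 2) (f : HSpace) (u v : ℝ) :
    inner ℂ (displacement u v hs.toLp) f = Complex.exp (Complex.I * (u * v : ℝ)) *
      𝓕 (fun x => f x * conj (s (x - √2 * u))) ((√2 * Real.pi)⁻¹ * v) := by
  have h2 : √2 * √2 = (2 : ℝ) := Real.mul_self_sqrt (by norm_num)
  rw [displacement_toLp, inner_toLp, Real.fourier_real_eq_integral_exp_smul, ← integral_const_mul]
  refine integral_congr_ae (.of_forall fun x => ?_)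
  simp only [dispFun, map_mul, ← Complex.exp_conj, smul_eq_mul, Complex.conj_I, Complex.conj_ofReal]
  rw [mul_left_comm, ← mul_assoc (Complex.exp _) (Complex.exp _), ← Complex.exp_add]
  congr 2
  have : -2 * Real.pi * x * ((√2 * Real.pi)⁻¹ * v) = -(√2 * v * x) := by
    have := Real.pi_ne_zero
    field_simp
    linear_combination (x * v) * h2
  rw [this]
  push_cast
  ring

open FourierTransform in
-- Orthogonality relation for the Heisenberg group: Plancherel in v gives the factor √2 π, then
-- Tonelli and translation in u give 1/√2. Boundedness of s keeps f times the shifted window in L²,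
-- as Plancherel requires.
theorem lintegral_inner_displacement {s : ℝ → ℂ} (hs : MemLp s 2) (hsc : Continuous s)
    {B : ℝ} (hB : ∀ x, ‖s x‖ ≤ B) (f : HSpace) :
    ∫⁻ p : ℝ × ℝ, ‖inner ℂ (displacement p.1 p.2 hs.toLp) f‖ₑ ^ 2 =
      ENNReal.ofReal Real.pi * (∫⁻ x, ‖s x‖ₑ ^ 2) * ∫⁻ x, ‖f x‖ₑ ^ 2 := by
  have hm := measurable_inner_displacement hs hsc f
  rw [Measure.volume_eq_prod, lintegral_prod _ (hm.enorm.pow_const 2).aemeasurable]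
  have hshift : ∀ u : ℝ, MemLp (fun x => conj (s (x - √2 * u))) 2 := fun u =>
    (hs.comp_measurePreserving (measurePreserving_sub_right volume (√2 * u))).star
  have key : ∀ u : ℝ, ∫⁻ v, ‖inner ℂ (displacement u v hs.toLp) f‖ₑ ^ 2 =
      ENNReal.ofReal (√2 * Real.pi) * ∫⁻ x, ‖f x‖ₑ ^ 2 * ‖s (x - √2 * u)‖ₑ ^ 2 := fun u => by
    have hi : Integrable (fun x => f x * conj (s (x - √2 * u))) :=
      (Lp.memLp f).integrable_mul (hshift u)
    have hL : MemLp (fun x => f x * conj (s (x - √2 * u))) 2 := by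
      refine (Lp.memLp f).of_le_mul (c := B) hi.1 (.of_forall fun x => ?_)
      rw [norm_mul, RCLike.norm_conj, mul_comm]
      exact mul_le_mul_of_nonneg_right (hB _) (norm_nonneg _)
    have hc : Continuous (𝓕 fun x => f x * conj (s (x - √2 * u))) :=
      VectorFourier.fourierIntegral_continuous Real.continuous_fourierChar continuous_inner hi
    have e : ∀ v, ‖inner ℂ (displacement u v hs.toLp) f‖ₑ ^ 2 =
        (fun ξ => ‖𝓕 (fun x => f x * conj (s (x - √2 * u))) ξ‖ₑ ^ 2)
          ((√2 * Real.pi)⁻¹ * v) := fun v => by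
      rw [inner_displacement_eq_fourier, enorm_mul, ← ofReal_norm, mul_comm Complex.I,
        Complex.norm_exp_ofReal_mul_I]
      simp
    simp_rw [e]
    rw [lintegral_comp_mul_left _ (by positivity)
      (fun ξ => ‖𝓕 (fun x => f x * conj (s (x - √2 * u))) ξ‖ₑ ^ 2) (by fun_prop), inv_inv,
      lintegral_enorm_fourier_sq hi hL]
    simp [enorm_mul, mul_pow]
  simp_rw [key]
  have hsm : Measurable s := hsc.measurable
  have hfm : Measurable fun x => ‖f x‖ₑ ^ 2 := (Lp.stronglyMeasurable f).enorm.pow_const 2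
  rw [lintegral_const_mul' _ _ ENNReal.ofReal_ne_top, lintegral_lintegral_swap]
  · have e : ∀ x, ∫⁻ u, ‖f x‖ₑ ^ 2 * ‖s (x - √2 * u)‖ₑ ^ 2 =
        (ENNReal.ofReal (√2)⁻¹ * ∫⁻ x, ‖s x‖ₑ ^ 2) * ‖f x‖ₑ ^ 2 := fun x => by
      rw [lintegral_const_mul _ (by measurability), mul_comm,
        lintegral_comp_mul_left (√2) (by positivity) (fun y => ‖s (x - y)‖ₑ ^ 2) (by measurability),
        lintegral_sub_left_eq_self (fun y => ‖s y‖ₑ ^ 2) x]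
    simp_rw [e]
    rw [lintegral_const_mul _ hfm, ← mul_assoc, ← mul_assoc, ← ENNReal.ofReal_mul (by positivity)]
    congr 3
    field_simp
  · refine Measurable.aemeasurable ?_
    simp only [Function.uncurry_def]
    exact (hfm.comp measurable_snd).mul (by measurability)

/-- The diagonal case suffices: the hypothesis makes f ↦ ⟨v(·), f⟩ equal to √C times an isometry
into L²(μ), so polarization recovers all inner products. Absolute convergence holds because the
integrand is a product of two L² functions. -/
theorem resolvesIdentity_of_lintegral {X : Type*} [MeasurableSpace X] {μ : Measure X} {C : ℝ}
    (hC : 0 < C) {v : X → HSpace}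
    (hm : ∀ f, AEStronglyMeasurable (fun x => inner ℂ (v x) f) μ)
    (h : ∀ f : HSpace, ∫⁻ x, ‖inner ℂ (v x) f‖ₑ ^ 2 ∂μ =
      ENNReal.ofReal C * ∫⁻ x, ‖f x‖ₑ ^ 2) : ResolvesIdentity μ (1 / C) v := by
  have hn : ∀ f : HSpace, eLpNorm (fun x => inner ℂ (v x) f) 2 μ ^ 2 =
      ENNReal.ofReal C * ‖f‖ₑ ^ 2 := fun f => by
    rw [eLpNorm_two_sq, h, ← eLpNorm_two_sq, Lp.enorm_def]
  have hL : ∀ f : HSpace, MemLp (fun x => inner ℂ (v x) f) 2 μ := fun f => by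
    refine ⟨hm f, lt_of_not_ge fun htop => ?_⟩
    have := hn f
    rw [top_le_iff.1 htop, ENNReal.top_pow two_ne_zero] at this
    exact ENNReal.mul_ne_top ENNReal.ofReal_ne_top (ENNReal.pow_ne_top enorm_ne_top) this.symm
  let V : HSpace →ₗ[ℂ] Lp ℂ 2 μ :=
    { toFun := fun f => (hL f).toLp
      map_add' := fun f g => by
        rw [← MemLp.toLp_add, MemLp.toLp_eq_toLp_iff]
        exact .of_forall fun x => inner_add_right _ _ _
      map_smul' := fun c f => by
        rw [RingHom.id_apply, ← MemLp.toLp_const_smul, MemLp.toLp_eq_toLp_iff]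
        exact .of_forall fun x => inner_smul_right _ _ _ }
  have hV : ∀ f, (‖V f‖ : ℂ) ^ 2 = C * (‖f‖ : ℂ) ^ 2 := fun f => by
    have h1 : ‖V f‖ₑ ^ 2 = ENNReal.ofReal C * ‖f‖ₑ ^ 2 := by
      rw [← hn f, Lp.enorm_def, ← eLpNorm_congr_ae (hL f).coeFn_toLp]
      rfl
    rw [← ofReal_norm, ← ofReal_norm, ← ENNReal.ofReal_pow (norm_nonneg _),
      ← ENNReal.ofReal_pow (norm_nonneg _), ← ENNReal.ofReal_mul hC.le,
      ENNReal.ofReal_eq_ofReal_iff (by positivity) (by positivity)] at h1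
    exact_mod_cast h1
  have hVi : ∀ f g, inner ℂ (V f) (V g) = C * inner ℂ f g := fun f g => by
    rw [inner_eq_sum_norm_sq_div_four (V f), inner_eq_sum_norm_sq_div_four f,
      ← map_smul, ← map_add, ← map_add, ← map_sub, ← map_sub]
    simp only [Complex.coe_algebraMap, hV]
    ring
  intro f g
  have hfun : (fun x => inner ℂ f (v x) * inner ℂ (v x) g) =
      fun x => inner ℂ (v x) g * conj (inner ℂ (v x) f) := by
    funext x
    rw [inner_conj_symm, mul_comm]
  rw [hfun]
  refine ⟨(hL g).integrable_mul (hL f).star, ?_⟩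
  have : ∫ x, inner ℂ (v x) g * conj (inner ℂ (v x) f) ∂μ = inner ℂ (V f) (V g) := by
    rw [L2.inner_def]
    refine integral_congr_ae ?_
    filter_upwards [(hL f).coeFn_toLp, (hL g).coeFn_toLp] with x hx hy
    simp only [V, LinearMap.coe_mk, AddHom.coe_mk]
    rw [hx, hy, RCLike.inner_apply]
  rw [this, hVi]
  have : (C : ℂ) ≠ 0 := by exact_mod_cast hC.ne'
  push_cast
  field_simp

/-! ### The fractional Fourier transform of Gaussians -/

/-- A Gaussian integral in which the normalisation of the kernel cancels exactly. The formula is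
uniform in θ and also covers the delta-function cases, where exp(iθ) = ±1. -/
theorem fracTransform_gaussian (x θ : ℝ) (k : ℂ) :
    fracTransform x θ (fun y => Complex.exp (-(y : ℂ) ^ 2 / 2 + k * y)) =
      Complex.exp (-(x : ℂ) ^ 2 / 2 + Complex.exp (Complex.I * θ) * k * x
        - Complex.I / 2 * Complex.exp (Complex.I * θ) * Real.sin θ * k ^ 2) := by
  have hI : Complex.I * Complex.I = -1 := Complex.I_mul_I
  have hE : Complex.exp (Complex.I * θ) = Real.cos θ + Complex.I * Real.sin θ := by
    rw [mul_comm Complex.I, Complex.exp_mul_I, Complex.ofReal_cos, Complex.ofReal_sin, mul_comm]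
  have hp : (Real.sin θ : ℂ) ^ 2 + (Real.cos θ : ℂ) ^ 2 = 1 := by
    exact_mod_cast Real.sin_sq_add_cos_sq θ
  rw [fracTransform, hE]
  split_ifs with hs
  · rw [hs] at hp ⊢
    congr 1
    push_cast at hp ⊢
    linear_combination -(x : ℂ) ^ 2 / 2 * hp
  · have hs' : (Real.sin θ : ℂ) ≠ 0 := by exact_mod_cast hs
    have hπ : (Real.pi : ℂ) ≠ 0 := by exact_mod_cast Real.pi_ne_zero
    have hcot : (Real.cot θ : ℂ) = Real.cos θ / Real.sin θ := by
      rw [Real.cot_eq_cos_div_sin]; push_cast; rfl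
    set q : ℂ := (1 + Complex.I * (Real.cot θ : ℂ)) / (2 * (Real.pi : ℂ)) with hq
    have hqre : 0 < q.re := by
      have : q = ((1 / (2 * Real.pi) : ℝ) : ℂ) + ((Real.cot θ / (2 * Real.pi) : ℝ) : ℂ)
          * Complex.I := by
        rw [hq]; push_cast; ring
      rw [this]
      simp only [Complex.add_re, Complex.ofReal_re, Complex.re_ofReal_mul, Complex.I_re, mul_zero,
        add_zero]
      positivity
    have hq0 : q ≠ 0 := fun h => by simp [h] at hqre
    -- Since 2πq = 1 + i cot θ, this is exp(iθ)(sin θ + i cos θ) = exp(iθ) · i exp(-iθ).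
    have hcn : (Real.cos θ + Complex.I * Real.sin θ) * (Real.sin θ * (2 * Real.pi * q)) =
        Complex.I := by
      rw [hq, hcot]
      field_simp
      linear_combination Complex.I * hp + (Complex.I * Real.cos θ ^ 2 - Complex.I * Real.cos θ ^ 2
        + Real.sin θ * Real.cos θ) * hI
    have hb : (-(Real.pi * q)).re < 0 := by
      rw [Complex.neg_re, Complex.re_ofReal_mul]
      have := mul_pos Real.pi_pos hqre
      linarith
    have h1 : ∀ y : ℝ, fracKernel x y θ * Complex.exp (-(y : ℂ) ^ 2 / 2 + k * y) =
        q ^ (1 / 2 : ℂ) * Complex.exp (-(Real.pi * q) * (y : ℂ) ^ 2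
          + (Complex.I * x / Real.sin θ + k) * y + -(Complex.I * Real.cot θ * x ^ 2 / 2)) := by
      intro y
      rw [fracKernel, ← hq, mul_assoc, ← Complex.exp_add]
      congr 2
      rw [hq]
      field_simp
      ring
    simp_rw [h1]
    rw [integral_const_mul, integral_cexp_quadratic hb, neg_neg, ← mul_assoc]
    -- The principal roots of q and 1/q are mutually inverse because Re q > 0 keeps q off the branch
    -- cut.
    have h2 : q ^ (1 / 2 : ℂ) * (Real.pi / (Real.pi * q)) ^ (1 / 2 : ℂ) = 1 := by
      have : (Real.pi : ℂ) / (Real.pi * q) = q⁻¹ := by field_simp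
      rw [this, Complex.inv_cpow, mul_inv_cancel₀]
      · simp [Complex.cpow_eq_zero_iff, hq0]
      · intro h
        have := Complex.arg_eq_pi_iff.1 h
        linarith [this.1]
    rw [h2, one_mul]
    congr 1
    set S : ℂ := (Real.sin θ : ℂ)
    set c : ℂ := (Real.cos θ : ℂ)
    have h4 : (4 * -(Real.pi * q))⁻¹ = (c + Complex.I * S) * S * Complex.I / 2 := by
      refine inv_eq_of_mul_eq_one_right ?_
      linear_combination -Complex.I * hcn - hI
    rw [div_eq_mul_inv _ (4 * -(Real.pi * q)), h4, hcot]
    -- Writing x as t sin θ removes the denominators and leaves a polynomial identity.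
    obtain ⟨t, ht⟩ : ∃ t : ℂ, (x : ℂ) = t * S := ⟨x / S, by field_simp⟩
    have e1 : Complex.I * x / S = Complex.I * t := by rw [ht]; field_simp
    have e2 : Complex.I * (c / S) * (x : ℂ) ^ 2 / 2 = Complex.I * c * t ^ 2 * S / 2 := by
      rw [ht]; field_simp
    rw [e1, e2, ht]
    linear_combination (t ^ 2 * S * (-(Complex.I * c) / 2 - S * (Complex.I * Complex.I - 1) / 2)
      - k * t * S * (c + Complex.I * S)) * hI

/-! ### Squeezed Gaussians -/

/-- The wave function of `exp (τ a†² / 2 + μ a†) |0⟩`. -/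
def squeezed (τ μ : ℂ) (x : ℝ) : ℂ :=
  ((Real.pi ^ (-(1 / 4) : ℝ) : ℝ) : ℂ) * ((1 + τ) ^ (1 / 2 : ℂ))⁻¹ *
    Complex.exp (-((1 - τ) / (1 + τ) / 2) * (x : ℂ) ^ 2 + √2 * μ / (1 + τ) * x
      + -(μ ^ 2 / (2 * (1 + τ))))

theorem continuous_squeezed (τ μ : ℂ) : Continuous (squeezed τ μ) := by
  unfold squeezed
  fun_prop

theorem re_one_add_pos {τ : ℂ} (hτ : ‖τ‖ < 1) : 0 < (1 + τ).re := by
  have := Complex.abs_re_le_norm τ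
  rw [Complex.add_re, Complex.one_re]
  linarith [neg_abs_le τ.re]

theorem one_add_ne_zero_of_norm_lt {τ : ℂ} (hτ : ‖τ‖ < 1) : 1 + τ ≠ 0 := fun h => by
  simpa [h] using re_one_add_pos hτ

/-- The Cayley transform sends the unit disc to the right half-plane, so |τ| < 1 makes the squeezed
Gaussian decay. -/
theorem re_cayley (τ : ℂ) (hτ : ‖τ‖ < 1) :
    ((1 - τ) / (1 + τ)).re = (1 - ‖τ‖ ^ 2) / ‖1 + τ‖ ^ 2 := by
  have h := one_add_ne_zero_of_norm_lt hτ
  rw [Complex.div_re, ← add_div, Complex.sq_norm, Complex.sq_norm, Complex.normSq_apply τ]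
  congr 1
  simp
  ring

theorem re_cayley_pos {τ : ℂ} (hτ : ‖τ‖ < 1) : 0 < ((1 - τ) / (1 + τ)).re := by
  have h := norm_pos_iff.2 (one_add_ne_zero_of_norm_lt hτ)
  rw [re_cayley τ hτ]
  have : ‖τ‖ ^ 2 < 1 := by
    have := norm_nonneg τ
    nlinarith
  exact div_pos (by linarith) (by positivity)

theorem sqrt_mul_self (z : ℂ) : z ^ (1 / 2 : ℂ) * z ^ (1 / 2 : ℂ) = z := by
  by_cases h : z = 0
  · simp [h]
  · rw [← Complex.cpow_add _ _ h]; norm_num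

theorem sqrt_ne_zero {z : ℂ} (h : z ≠ 0) : z ^ (1 / 2 : ℂ) ≠ 0 := fun h' => by
  have := sqrt_mul_self z
  rw [h', zero_mul] at this
  exact h this.symm

theorem sqrt_ofReal_mul {r : ℝ} (hr : 0 < r) (z : ℂ) :
    ((r : ℂ) * z) ^ (1 / 2 : ℂ) = (√r : ℝ) * z ^ (1 / 2 : ℂ) := by
  by_cases h : z = 0
  · simp [h]
  · have hr' : (r : ℂ) ≠ 0 := by exact_mod_cast hr.ne'
    rw [Complex.cpow_def_of_ne_zero (mul_ne_zero hr' h), Complex.cpow_def_of_ne_zero h,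
      Complex.log_ofReal_mul hr h, add_mul, Complex.exp_add, Real.sqrt_eq_rpow,
      Complex.ofReal_cpow hr.le, Complex.cpow_def_of_ne_zero hr', Complex.ofReal_log hr.le]
    push_cast
    rfl

/-- The Bargmann representation: pairing with exp(ζ a†)|0⟩ replaces a† by the conjugate of ζ. Here
it is a Gaussian integral in which the two factors (1 + τ)^(±1/2) cancel. -/
theorem integral_squeezed_mul_conj {τ : ℂ} (hτ : ‖τ‖ < 1) (μ ζ : ℂ) :
    ∫ x, squeezed τ μ x * conj (squeezed 0 ζ x) =
      Complex.exp (τ / 2 * conj ζ ^ 2 + μ * conj ζ) := by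
  have h0 := one_add_ne_zero_of_norm_lt hτ
  have h2 : (√2 : ℂ) * √2 = 2 := by
    rw [← Complex.ofReal_mul, Real.mul_self_sqrt (by norm_num)]; norm_num
  have hb : (-(1 + τ)⁻¹).re < 0 := by
    rw [Complex.neg_re, Complex.inv_re]
    have := div_pos (re_one_add_pos hτ) (Complex.normSq_pos.2 h0)
    linarith
  have e : ∀ x : ℝ, squeezed τ μ x * conj (squeezed 0 ζ x) =
      ((Real.pi ^ (-(1 / 2) : ℝ) : ℝ) : ℂ) * ((1 + τ) ^ (1 / 2 : ℂ))⁻¹ *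
        Complex.exp (-(1 + τ)⁻¹ * (x : ℂ) ^ 2 + √2 * (μ / (1 + τ) + conj ζ) * x
          + -(μ ^ 2 / (2 * (1 + τ)) + conj ζ ^ 2 / 2)) := fun x => by
    have hπ : ((Real.pi ^ (-(1 / 2) : ℝ) : ℝ) : ℂ) =
        ((Real.pi ^ (-(1 / 4) : ℝ) : ℝ) : ℂ) * ((Real.pi ^ (-(1 / 4) : ℝ) : ℝ) : ℂ) := by
      rw [← Complex.ofReal_mul, ← Real.rpow_add Real.pi_pos]; norm_num
    rw [hπ]
    simp only [squeezed, map_mul, ← Complex.exp_conj, map_add, map_neg, map_div₀, map_pow,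
      map_one, Complex.conj_ofReal, map_ofNat, add_zero, sub_zero,
      Complex.one_cpow, inv_one, mul_one, div_one]
    rw [mul_mul_mul_comm, ← Complex.exp_add, mul_right_comm _ _ (((Real.pi ^ _ : ℝ)) : ℂ)]
    congr 2
    field_simp
    ring
  simp_rw [e]
  rw [integral_const_mul, integral_cexp_quadratic hb, neg_neg, div_inv_eq_mul,
    sqrt_ofReal_mul Real.pi_pos, ← mul_assoc]
  have h3 : ((Real.pi ^ (-(1 / 2) : ℝ) : ℝ) : ℂ) * (√Real.pi : ℝ) = 1 := by
    rw [← Complex.ofReal_mul, Real.sqrt_eq_rpow, ← Real.rpow_add Real.pi_pos]; norm_num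
  have h4 := inv_mul_cancel₀ (sqrt_ne_zero h0)
  have h5 : ∀ a b c d : ℂ, a * b * (c * d) = (a * c) * (b * d) := fun _ _ _ _ => by ring
  rw [h5, h3, h4, one_mul, one_mul]
  congr 1
  field_simp
  linear_combination (2 * (μ + (1 + τ) * conj ζ) ^ 2) * h2

/-- The normal-ordered form D(u, v)|0⟩ = exp(-|z|²/2) exp(z a†)|0⟩ with z = u + iv. -/
theorem dispFun_vacuum (u v x : ℝ) :
    dispFun u v vacuum x =
      ((Real.exp (-(u ^ 2 + v ^ 2) / 2) : ℝ) : ℂ) * squeezed 0 (u + Complex.I * v) x := by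
  have h2 : (√2 : ℂ) * √2 = 2 := by
    rw [← Complex.ofReal_mul, Real.mul_self_sqrt (by norm_num)]; norm_num
  rw [dispFun, vacuum_apply, squeezed]
  simp only [add_zero, sub_zero, Complex.one_cpow, inv_one, mul_one, div_one]
  push_cast
  rw [mul_left_comm, mul_left_comm (Complex.exp _), ← Complex.exp_add, ← Complex.exp_add]
  congr 2
  linear_combination (-(u : ℂ) ^ 2 / 2) * h2 + ((v : ℂ) ^ 2 / 2) * Complex.I_sq

/-! ### Gaussians as elements of `L²` -/

/-- The Gaussian `exp (-a x² + ν x)`. -/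
def expQuad (a ν : ℂ) (x : ℝ) : ℂ := Complex.exp (-a * (x : ℂ) ^ 2 + ν * x)

theorem continuous_expQuad (a ν : ℂ) : Continuous (expQuad a ν) := by
  unfold expQuad
  fun_prop

theorem expQuad_add (a ν h : ℂ) (x : ℝ) :
    expQuad a (ν + h) x = expQuad a ν x * Complex.exp (h * x) := by
  rw [expQuad, expQuad, ← Complex.exp_add]
  ring_nf

theorem memLp_expQuad {a : ℂ} (ha : 0 < a.re) (ν : ℂ) : MemLp (expQuad a ν) 2 := by
  rw [memLp_two_iff_integrable_sq_norm (continuous_expQuad a ν).aestronglyMeasurable]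
  have h : (-(2 * a)).re < 0 := by simpa using ha
  refine (integrable_cexp_quadratic' h (2 * ν) 0).norm.congr (.of_forall fun x => ?_)
  simp only [expQuad]
  rw [← norm_pow, ← Complex.exp_nat_mul]
  congr 2
  push_cast
  ring

/-- Follows from exp(c|x|) ≤ exp(cx) + exp(-cx), each exponential being absorbed into ν. It supplies
the dominating function for differentiation in ν. -/
theorem memLp_exp_mul_expQuad {a : ℂ} (ha : 0 < a.re) (ν : ℂ) (c : ℝ) :
    MemLp (fun x => (Real.exp (c * |x|) : ℂ) * expQuad a ν x) 2 := by
  have h1 := (memLp_expQuad ha (ν + c)).norm.add (memLp_expQuad ha (ν + (-c : ℝ))).norm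
  refine h1.of_le (Continuous.aestronglyMeasurable ?_) (.of_forall fun x => ?_)
  · have := continuous_expQuad a ν
    fun_prop
  · simp only [Pi.add_apply, expQuad_add, norm_mul]
    rw [Real.norm_of_nonneg (by positivity), ← mul_add, mul_comm]
    refine mul_le_mul_of_nonneg_left ?_ (norm_nonneg _)
    rw [Complex.norm_real, Real.norm_of_nonneg (Real.exp_pos _).le, Complex.norm_exp,
      Complex.norm_exp, ← Complex.ofReal_mul, ← Complex.ofReal_mul, Complex.ofReal_re,
      Complex.ofReal_re]
    rcases abs_cases x with ⟨h, _⟩ | ⟨h, _⟩ <;> rw [h]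
    · linarith [Real.exp_pos (-c * x)]
    · rw [mul_neg, neg_mul]
      linarith [Real.exp_pos (c * x)]

theorem memLp_mul_expQuad {a : ℂ} (ha : 0 < a.re) (ν : ℂ) :
    MemLp (fun x : ℝ => (x : ℂ) * expQuad a ν x) 2 := by
  refine (memLp_exp_mul_expQuad ha ν 1).of_le (Continuous.aestronglyMeasurable ?_)
    (.of_forall fun x => ?_)
  · have := continuous_expQuad a ν
    fun_prop
  · rw [norm_mul, norm_mul]
    refine mul_le_mul_of_nonneg_right ?_ (norm_nonneg _)
    rw [Complex.norm_real, Complex.norm_real, Real.norm_of_nonneg (Real.exp_pos _).le, one_mul,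
      Real.norm_eq_abs]
    linarith [Real.add_one_le_exp |x|]

theorem hasDerivAt_toLp_expQuad {a : ℂ} (ha : 0 < a.re) (ν : ℂ) :
    HasDerivAt (fun ν => ((memLp_expQuad ha ν).toLp : HSpace)) (memLp_mul_expQuad ha ν).toLp ν := by
  rw [hasDerivAt_iff_isLittleO_nhds_zero]
  -- For |h| ≤ 1 the Taylor remainder of exp(hx) is at most |h|²|x|² exp|x| ≤ 2|h|² exp(2|x|), so
  -- the weight exp(3|x|) is ample.
  set W : HSpace := (memLp_exp_mul_expQuad ha ν 3).toLp with hW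
  have hO : (fun h : ℂ => ((memLp_expQuad ha (ν + h)).toLp : HSpace) - (memLp_expQuad ha ν).toLp -
      h • (memLp_mul_expQuad ha ν).toLp) =O[nhds 0] fun h : ℂ => h ^ 2 := by
    refine Asymptotics.IsBigO.of_bound (2 * ‖W‖) ?_
    filter_upwards [Metric.closedBall_mem_nhds (0 : ℂ) one_pos] with h hh
    rw [mem_closedBall_zero_iff] at hh
    rw [← MemLp.toLp_sub, ← MemLp.toLp_const_smul, ← MemLp.toLp_sub, norm_pow,
      mul_comm (2 : ℝ), mul_assoc, mul_comm ‖W‖]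
    refine Lp.norm_le_mul_norm_of_ae_le_mul ?_
    filter_upwards [MemLp.coeFn_toLp (((memLp_expQuad ha (ν + h)).sub (memLp_expQuad ha ν)).sub
      ((memLp_mul_expQuad ha ν).const_smul h)), (memLp_exp_mul_expQuad ha ν 3).coeFn_toLp]
      with x hx hx'
    rw [hx, hW, hx']
    simp only [Pi.sub_apply, Pi.smul_apply, smul_eq_mul, expQuad_add]
    have e : expQuad a ν x * Complex.exp (h * x) - expQuad a ν x - h * (x * expQuad a ν x) =
        (Complex.exp (h * x) - ∑ m ∈ Finset.range 2, (h * x) ^ m / m.factorial) *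
          expQuad a ν x := by
      simp [Finset.sum_range_succ]
      ring
    rw [e, norm_mul, norm_mul, ← mul_assoc]
    refine mul_le_mul_of_nonneg_right ?_ (norm_nonneg _)
    refine (Complex.norm_exp_sub_sum_le_norm_mul_exp _ _).trans ?_
    rw [norm_mul, mul_pow, Complex.norm_real, Complex.norm_real, Real.norm_eq_abs,
      Real.norm_of_nonneg (Real.exp_pos _).le, mul_comm 2, mul_assoc, mul_assoc]
    refine mul_le_mul_of_nonneg_left ?_ (by positivity)
    have h1 : ‖h‖ * |x| ≤ |x| := mul_le_of_le_one_left (abs_nonneg _) hh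
    have h2 := Real.pow_div_factorial_le_exp |x| (abs_nonneg _) 2
    have h3 : |x| ^ 2 ≤ 2 * Real.exp |x| := by
      norm_num at h2
      rw [sq_abs]
      linarith
    calc |x| ^ 2 * Real.exp (‖h‖ * |x|) ≤ 2 * Real.exp |x| * Real.exp |x| := by gcongr
      _ = 2 * Real.exp (2 * |x|) := by rw [mul_assoc, ← Real.exp_add]; ring_nf
      _ ≤ 2 * Real.exp (3 * |x|) := by gcongr; norm_num
  refine hO.trans_isLittleO ?_
  exact Asymptotics.isLittleO_pow_id one_lt_two

theorem squeezed_eq (τ μ : ℂ) : squeezed τ μ =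
    (((Real.pi ^ (-(1 / 4) : ℝ) : ℝ) : ℂ) * ((1 + τ) ^ (1 / 2 : ℂ))⁻¹ *
      Complex.exp (-(μ ^ 2 / (2 * (1 + τ))))) •
        expQuad ((1 - τ) / (1 + τ) / 2) (√2 * μ / (1 + τ)) := by
  funext x
  rw [Pi.smul_apply, smul_eq_mul, squeezed, expQuad, Complex.exp_add]
  ring

theorem re_cayley_half_pos {τ : ℂ} (hτ : ‖τ‖ < 1) : 0 < ((1 - τ) / (1 + τ) / 2).re := by
  have := re_cayley_pos hτ
  rw [show (2 : ℂ) = ((2 : ℝ) : ℂ) by norm_num, Complex.div_ofReal_re]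
  positivity

theorem memLp_squeezed {τ : ℂ} (hτ : ‖τ‖ < 1) (μ : ℂ) : MemLp (squeezed τ μ) 2 := by
  rw [squeezed_eq]
  exact (memLp_expQuad (re_cayley_half_pos hτ) _).const_smul _

theorem differentiable_toLp_squeezed {τ : ℂ} (hτ : ‖τ‖ < 1) :
    Differentiable ℂ fun μ => ((memLp_squeezed hτ μ).toLp : HSpace) := by
  have e : (fun μ => ((memLp_squeezed hτ μ).toLp : HSpace)) = fun μ =>
      (((Real.pi ^ (-(1 / 4) : ℝ) : ℝ) : ℂ) * ((1 + τ) ^ (1 / 2 : ℂ))⁻¹ *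
      Complex.exp (-(μ ^ 2 / (2 * (1 + τ))))) •
        ((memLp_expQuad (re_cayley_half_pos hτ) (√2 * μ / (1 + τ))).toLp : HSpace) := by
    funext μ
    rw [← MemLp.toLp_const_smul, MemLp.toLp_eq_toLp_iff, squeezed_eq]
  rw [e]
  have h1 : Differentiable ℂ fun ν =>
      ((memLp_expQuad (re_cayley_half_pos hτ) ν).toLp : HSpace) :=
    fun ν => (hasDerivAt_toLp_expQuad (re_cayley_half_pos hτ) ν).differentiableAt
  have h2 : Differentiable ℂ fun μ : ℂ => √2 * μ / (1 + τ) := by fun_prop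
  have h3 : Differentiable ℂ fun μ : ℂ =>
      ((Real.pi ^ (-(1 / 4) : ℝ) : ℝ) : ℂ) * ((1 + τ) ^ (1 / 2 : ℂ))⁻¹ *
      Complex.exp (-(μ ^ 2 / (2 * (1 + τ)))) := by fun_prop
  exact h3.smul (h1.comp h2)

theorem norm_squeezed_zero_sq {τ : ℂ} (hτ : ‖τ‖ < 1) (x : ℝ) :
    ‖squeezed τ 0 x‖ ^ 2 = Real.pi ^ (-(1 / 2) : ℝ) * ‖1 + τ‖⁻¹ *
      Real.exp (-((1 - ‖τ‖ ^ 2) / ‖1 + τ‖ ^ 2) * x ^ 2) := by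
  have h1 : ‖(1 + τ) ^ (1 / 2 : ℂ)‖ ^ 2 = ‖1 + τ‖ := by
    rw [← norm_pow, pow_two, sqrt_mul_self]
  rw [squeezed, norm_mul, norm_mul, mul_pow, mul_pow, norm_inv, inv_pow, h1, Complex.norm_exp,
    ← Real.exp_nat_mul, Complex.norm_real, Real.norm_of_nonneg (by positivity),
    ← Real.rpow_natCast, ← Real.rpow_mul Real.pi_pos.le, ← re_cayley τ hτ]
  congr 2
  · norm_num
  · have : -((1 - τ) / (1 + τ) / 2) * (x : ℂ) ^ 2 + √2 * 0 / (1 + τ) * x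
        + -(0 ^ 2 / (2 * (1 + τ))) = ((-(x ^ 2 / 2) : ℝ) : ℂ) * ((1 - τ) / (1 + τ)) := by
      push_cast
      ring
    rw [this, Complex.re_ofReal_mul]
    push_cast
    ring

theorem norm_squeezed_zero_le {τ : ℂ} (hτ : ‖τ‖ < 1) (x : ℝ) :
    ‖squeezed τ 0 x‖ ≤ 1 + Real.pi ^ (-(1 / 2) : ℝ) * ‖1 + τ‖⁻¹ := by
  have h := norm_squeezed_zero_sq hτ x
  have h0 : (1 - ‖τ‖ ^ 2) / ‖1 + τ‖ ^ 2 * x ^ 2 ≥ 0 := by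
    rw [← re_cayley τ hτ]
    have := re_cayley_pos hτ
    positivity
  have h1 : Real.exp (-((1 - ‖τ‖ ^ 2) / ‖1 + τ‖ ^ 2) * x ^ 2) ≤ 1 := by
    rw [Real.exp_le_one_iff]; linarith
  have h2 : ‖squeezed τ 0 x‖ ^ 2 ≤ Real.pi ^ (-(1 / 2) : ℝ) * ‖1 + τ‖⁻¹ := by
    rw [h]
    exact mul_le_of_le_one_right (by positivity) h1
  nlinarith [sq_nonneg (‖squeezed τ 0 x‖ - 1), norm_nonneg (squeezed τ 0 x)]

theorem lintegral_squeezed_sq {τ : ℂ} (hτ : ‖τ‖ < 1) :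
    ∫⁻ x, ‖squeezed τ 0 x‖ₑ ^ 2 = ENNReal.ofReal (√(1 - ‖τ‖ ^ 2))⁻¹ := by
  have hL := (memLp_two_iff_integrable_sq_norm
    (continuous_squeezed τ 0).aestronglyMeasurable).1 (memLp_squeezed hτ 0)
  have e : ∀ x, ‖squeezed τ 0 x‖ₑ ^ 2 = ENNReal.ofReal (‖squeezed τ 0 x‖ ^ 2) := fun x => by
    rw [ENNReal.ofReal_pow (norm_nonneg _), ofReal_norm]
  simp_rw [e]
  rw [← ofReal_integral_eq_lintegral_ofReal hL (.of_forall fun x => by positivity)]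
  congr 1
  simp_rw [norm_squeezed_zero_sq hτ]
  have hn : 0 < ‖1 + τ‖ := norm_pos_iff.2 (one_add_ne_zero_of_norm_lt hτ)
  have hp : 0 < 1 - ‖τ‖ ^ 2 := by nlinarith [norm_nonneg τ]
  rw [integral_const_mul, integral_gaussian, div_div_eq_mul_div, Real.sqrt_div (by positivity),
    Real.sqrt_mul Real.pi_pos.le, Real.sqrt_sq hn.le, Real.sqrt_eq_rpow Real.pi]
  have h3 : Real.pi ^ (-(1 / 2) : ℝ) * Real.pi ^ (1 / 2 : ℝ) = 1 := by
    rw [← Real.rpow_add Real.pi_pos]; norm_num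
  have h4 := (Real.sqrt_pos.2 hp).ne'
  field_simp
  linear_combination h3

/-- With z = u + iv, conjugation by D(u, v) sends a† to a† - z̄. Expanding exp(τ(a† - z̄)²/2) D(u,
v)|0⟩ yields the linear parameter z - τz̄ and the scalar; the proof compares exponents. -/
theorem squeezed_sub_mul_conj {τ : ℂ} (hτ : ‖τ‖ < 1) (u v x : ℝ) :
    squeezed τ ((u + Complex.I * v) - τ * (u - Complex.I * v)) x =
      Complex.exp (((u : ℂ) ^ 2 + v ^ 2) / 2 - τ / 2 * (u - Complex.I * v) ^ 2) *
        dispFun u v (squeezed τ 0) x := by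
  have h0 := one_add_ne_zero_of_norm_lt hτ
  have hI : Complex.I ^ 2 = -1 := Complex.I_sq
  have h2 : (√2 : ℂ) * √2 = 2 := by
    rw [← Complex.ofReal_mul, Real.mul_self_sqrt (by norm_num)]; norm_num
  rw [dispFun, squeezed, squeezed, ← mul_assoc (Complex.exp _) (Complex.exp _), ← Complex.exp_add,
    mul_left_comm (Complex.exp _), ← Complex.exp_add]
  congr 2
  obtain ⟨r, hr⟩ : ∃ r : ℂ, r * (1 + τ) = 1 := ⟨(1 + τ)⁻¹, inv_mul_cancel₀ h0⟩
  have e1 : (1 + τ)⁻¹ = r := inv_eq_of_mul_eq_one_left hr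
  push_cast
  simp only [div_eq_mul_inv, mul_inv, e1]
  linear_combination (√2 * x * Complex.I * v + ((1 - τ) * u ^ 2 / 2 - (1 - τ) * Complex.I * u * v
    - Complex.I ^ 2 * (1 + τ) * v ^ 2 / 2)) * hr + ((1 - τ) * r * u ^ 2 / 2) * h2
    - (v : ℂ) ^ 2 / 2 * hI

/-! ### Decay of the matrix elements of the displacement operators -/

/-- The matrix element `⟨φ| D(u, v) |ψ⟩`. -/
def dispElem (φ ψ : 𝓢(ℝ, ℂ)) (u v : ℝ) : ℂ :=
  inner ℂ (φ.toLp 2 (volume : Measure ℝ) : HSpace)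
    (displacement u v (ψ.toLp 2 (volume : Measure ℝ)))

theorem dispElem_eq (φ ψ : 𝓢(ℝ, ℂ)) (u v : ℝ) :
    dispElem φ ψ u v = ∫ x, conj (φ x) * dispFun u v ψ x := by
  have h : displacement u v (ψ.toLp 2 (volume : Measure ℝ)) =
      (memLp_dispFun u v (ψ.memLp 2)).toLp := displacement_toLp (ψ.memLp 2) u v
  rw [dispElem, h, ← inner_conj_symm, inner_toLp, ← integral_conj]
  refine integral_congr_ae ?_
  filter_upwards [φ.coeFn_toLp 2 (volume : Measure ℝ)] with x hx
  simp [hx]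

theorem integrable_conj_mul_dispFun (φ ψ : 𝓢(ℝ, ℂ)) (u v : ℝ) :
    Integrable fun x => conj (φ x) * dispFun u v ψ x :=
  (φ.memLp 2).star.integrable_mul (memLp_dispFun u v (ψ.memLp 2))

theorem norm_dispElem_le (φ ψ : 𝓢(ℝ, ℂ)) (u v : ℝ) : ‖dispElem φ ψ u v‖ ≤
    ‖(φ.toLp 2 (volume : Measure ℝ) : HSpace)‖ * ‖(ψ.toLp 2 (volume : Measure ℝ) : HSpace)‖ := by
  refine (norm_inner_le_norm _ _).trans (le_of_eq ?_)
  rw [LinearIsometryEquiv.norm_map]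

/-- The position operator on Schwartz functions. -/
def posS : 𝓢(ℝ, ℂ) →L[ℝ] 𝓢(ℝ, ℂ) := SchwartzMap.smulLeftCLM ℂ (fun x : ℝ => x)

theorem posS_apply (φ : 𝓢(ℝ, ℂ)) (x : ℝ) : posS φ x = x * φ x := by
  rw [posS, SchwartzMap.smulLeftCLM_apply_apply (by fun_prop), Complex.real_smul]

/-- Write √2 u = x - (x - √2 u): the first term acts on φ, the second on the translated ψ. -/
theorem pos_mul_dispElem (φ ψ : 𝓢(ℝ, ℂ)) (u v : ℝ) :
    √2 * u * dispElem φ ψ u v = dispElem (posS φ) ψ u v - dispElem φ (posS ψ) u v := by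
  simp only [dispElem_eq]
  rw [← integral_const_mul, ← integral_sub (integrable_conj_mul_dispFun _ _ _ _)
    (integrable_conj_mul_dispFun _ _ _ _)]
  refine integral_congr_ae (.of_forall fun x => ?_)
  simp only [dispFun, posS_apply, map_mul, Complex.conj_ofReal]
  push_cast
  ring

/-- The momentum counterpart: differentiating the displaced function brings down i√2 v, and
integration by parts moves the derivative onto φ. -/
theorem mom_mul_dispElem (φ ψ : 𝓢(ℝ, ℂ)) (u v : ℝ) :
    Complex.I * √2 * v * dispElem φ ψ u v =
      -dispElem (SchwartzMap.derivCLM ℂ ℂ φ) ψ u v -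
        dispElem φ (SchwartzMap.derivCLM ℂ ℂ ψ) u v := by
  have hd : ∀ x, HasDerivAt (dispFun u v ψ) (Complex.I * √2 * v * dispFun u v ψ x +
      dispFun u v (SchwartzMap.derivCLM ℂ ℂ ψ) x) x := fun x => by
    have d1 : HasDerivAt (fun y : ℝ => √2 * v * y - u * v) (√2 * v) x := by
      simpa using ((hasDerivAt_id x).const_mul (√2 * v)).sub_const (u * v)
    have d2 : HasDerivAt (fun y : ℝ => y - √2 * u) 1 x := (hasDerivAt_id x).sub_const _
    refine ((d1.ofReal_comp.const_mul Complex.I).cexp.mul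
      ((ψ.hasDerivAt _).scomp x d2)).congr_deriv ?_
    simp only [dispFun, Function.comp, SchwartzMap.derivCLM_apply, one_smul]
    push_cast
    ring
  have hφ : ∀ x, HasDerivAt (fun x => conj (φ x)) (conj (SchwartzMap.derivCLM ℂ ℂ φ x)) x :=
    fun x => (φ.hasDerivAt x).star
  have i1 := integrable_conj_mul_dispFun φ ψ u v
  have i2 := integrable_conj_mul_dispFun (SchwartzMap.derivCLM ℂ ℂ φ) ψ u v
  have i3 := integrable_conj_mul_dispFun φ (SchwartzMap.derivCLM ℂ ℂ ψ) u v
  have e : (fun x => conj (φ x) * (Complex.I * √2 * v * dispFun u v ψ x +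
      dispFun u v (SchwartzMap.derivCLM ℂ ℂ ψ) x)) = fun x =>
      Complex.I * √2 * v * (conj (φ x) * dispFun u v ψ x) +
        conj (φ x) * dispFun u v (SchwartzMap.derivCLM ℂ ℂ ψ) x := by
    funext x; ring
  have key := integral_mul_deriv_eq_deriv_mul_of_integrable (fun x _ => hφ x) (fun x _ => hd x)
    (by
      change Integrable (fun x => conj (φ x) * (Complex.I * √2 * v * dispFun u v ψ x +
        dispFun u v (SchwartzMap.derivCLM ℂ ℂ ψ) x))
      rw [e]
      exact (i1.const_mul _).add i3) i2 i1
  rw [e, integral_add (i1.const_mul _) i3, integral_const_mul] at key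
  rw [dispElem_eq, dispElem_eq, dispElem_eq]
  linear_combination key

/-- Each factor of u or v is traded for matrix elements of other Schwartz functions, down to the
Cauchy–Schwarz bound; hence the induction varies φ and ψ. -/
theorem exists_pow_mul_dispElem_le (m n : ℕ) (φ ψ : 𝓢(ℝ, ℂ)) :
    ∃ C : ℝ, ∀ u v : ℝ, |u| ^ m * |v| ^ n * ‖dispElem φ ψ u v‖ ≤ C := by
  have hs : (1 : ℝ) ≤ √2 := Real.one_le_sqrt.2 (by norm_num)
  induction m generalizing φ ψ with
  | zero =>
    induction n generalizing φ ψ with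
    | zero => exact ⟨_, fun u v => by simpa using norm_dispElem_le φ ψ u v⟩
    | succ n ih =>
      obtain ⟨C, hC⟩ := ih (SchwartzMap.derivCLM ℂ ℂ φ) ψ
      obtain ⟨D, hD⟩ := ih φ (SchwartzMap.derivCLM ℂ ℂ ψ)
      refine ⟨C + D, fun u v => ?_⟩
      have h := congrArg norm (mom_mul_dispElem φ ψ u v)
      simp only [norm_mul, Complex.norm_I, Complex.norm_real, Real.norm_eq_abs, one_mul,
        abs_of_nonneg (Real.sqrt_nonneg 2)] at h
      have h1 : |v| * ‖dispElem φ ψ u v‖ ≤ √2 * |v| * ‖dispElem φ ψ u v‖ := by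
        rw [mul_assoc]
        exact le_mul_of_one_le_left (by positivity) hs
      have h2 := norm_sub_le (-dispElem (SchwartzMap.derivCLM ℂ ℂ φ) ψ u v)
        (dispElem φ (SchwartzMap.derivCLM ℂ ℂ ψ) u v)
      rw [norm_neg] at h2
      calc |u| ^ 0 * |v| ^ (n + 1) * ‖dispElem φ ψ u v‖
          = |u| ^ 0 * |v| ^ n * (|v| * ‖dispElem φ ψ u v‖) := by ring
        _ ≤ |u| ^ 0 * |v| ^ n * (‖dispElem (SchwartzMap.derivCLM ℂ ℂ φ) ψ u v‖ +
            ‖dispElem φ (SchwartzMap.derivCLM ℂ ℂ ψ) u v‖) :=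
          mul_le_mul_of_nonneg_left (by linarith) (by positivity)
        _ ≤ C + D := by rw [mul_add]; exact add_le_add (hC u v) (hD u v)
  | succ m ih =>
    obtain ⟨C, hC⟩ := ih (posS φ) ψ
    obtain ⟨D, hD⟩ := ih φ (posS ψ)
    refine ⟨C + D, fun u v => ?_⟩
    have h := congrArg norm (pos_mul_dispElem φ ψ u v)
    simp only [norm_mul, Complex.norm_real, Real.norm_eq_abs,
      abs_of_nonneg (Real.sqrt_nonneg 2)] at h
    have h1 : |u| * ‖dispElem φ ψ u v‖ ≤ √2 * |u| * ‖dispElem φ ψ u v‖ := by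
      rw [mul_assoc]
      exact le_mul_of_one_le_left (by positivity) hs
    have h2 := norm_sub_le (dispElem (posS φ) ψ u v) (dispElem φ (posS ψ) u v)
    calc |u| ^ (m + 1) * |v| ^ n * ‖dispElem φ ψ u v‖
        = |u| ^ m * |v| ^ n * (|u| * ‖dispElem φ ψ u v‖) := by ring
      _ ≤ |u| ^ m * |v| ^ n * (‖dispElem (posS φ) ψ u v‖ + ‖dispElem φ (posS ψ) u v‖) :=
        mul_le_mul_of_nonneg_left (by linarith) (by positivity)
      _ ≤ C + D := by rw [mul_add]; exact add_le_add (hC u v) (hD u v)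

theorem measurable_dispElem (φ ψ : 𝓢(ℝ, ℂ)) :
    StronglyMeasurable fun p : ℝ × ℝ => dispElem φ ψ p.1 p.2 := by
  have h := measurable_inner_displacement (ψ.memLp 2) ψ.continuous (φ.toLp 2 (volume : Measure ℝ))
  have e : (fun p : ℝ × ℝ => dispElem φ ψ p.1 p.2) = fun p => conj (inner ℂ
      (displacement p.1 p.2 (ψ.memLp 2).toLp) (φ.toLp 2 (volume : Measure ℝ) : HSpace)) := by
    funext p
    rw [inner_conj_symm]
    rfl
  rw [e]
  exact Complex.continuous_conj.comp_stronglyMeasurable h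

theorem integrable_dispElem (φ ψ : 𝓢(ℝ, ℂ)) :
    Integrable fun p : ℝ × ℝ => dispElem φ ψ p.1 p.2 := by
  obtain ⟨C₀, h0⟩ := exists_pow_mul_dispElem_le 0 0 φ ψ
  obtain ⟨C₁, h1⟩ := exists_pow_mul_dispElem_le 2 0 φ ψ
  obtain ⟨C₂, h2⟩ := exists_pow_mul_dispElem_le 0 2 φ ψ
  obtain ⟨C₃, h3⟩ := exists_pow_mul_dispElem_le 2 2 φ ψ
  have hi : Integrable fun p : ℝ × ℝ => (1 + p.1 ^ 2)⁻¹ * (1 + p.2 ^ 2)⁻¹ :=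
    integrable_inv_one_add_sq.mul_prod integrable_inv_one_add_sq
  refine (hi.const_mul (C₀ + C₁ + C₂ + C₃)).mono' (measurable_dispElem φ ψ).aestronglyMeasurable
    (.of_forall fun p => ?_)
  have := h0 p.1 p.2
  have := h1 p.1 p.2
  have := h2 p.1 p.2
  have := h3 p.1 p.2
  simp only [pow_zero, one_mul, mul_one, sq_abs] at *
  rw [← mul_inv, ← div_eq_mul_inv, le_div_iff₀ (by positivity)]
  nlinarith

/-! ### Fubini's theorem for the fractional Fourier transform -/

theorem norm_fracKernel (x y θ : ℝ) : ‖fracKernel x y θ‖ =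
    ‖((1 + Complex.I * (Real.cot θ : ℂ)) / (2 * (Real.pi : ℂ))) ^ (1 / 2 : ℂ)‖ := by
  have : -Complex.I * ((x : ℂ) ^ 2 + (y : ℂ) ^ 2) * (Real.cot θ : ℂ) / 2
      + Complex.I * (x : ℂ) * (y : ℂ) / (Real.sin θ : ℂ) =
      ((-(x ^ 2 + y ^ 2) * Real.cot θ / 2 + x * y / Real.sin θ : ℝ) : ℂ) * Complex.I := by
    push_cast
    ring
  rw [fracKernel, norm_mul, this, Complex.norm_exp_ofReal_mul_I, mul_one]

theorem fracTransform_const_mul (x θ : ℝ) (c : ℂ) (f : ℝ → ℂ) :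
    fracTransform x θ (fun y => c * f y) = c * fracTransform x θ f := by
  rw [fracTransform, fracTransform]
  split_ifs
  · rfl
  · rw [← integral_const_mul]
    congr 1
    funext y
    ring

/-- The kernel has modulus constant in y, and the dominating Gaussians differ only by their centres
m(t), so their mass does not depend on t. Integrability of h then justifies Fubini. -/
theorem fracTransform_integral {X : Type*} [MeasurableSpace X] {ν : Measure X} [SFinite ν]
    (x θ : ℝ) {h : X → ℂ} (hh : Integrable h ν) {g : X → ℝ → ℂ}
    (hg : Measurable (Function.uncurry g)) {m : X → ℝ} (hm : Measurable m)
    (hb : ∀ t y, ‖g t y‖ ≤ Real.exp (-(1 / 2) * (y - m t) ^ 2)) :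
    fracTransform x θ (fun y => ∫ t, h t * g t y ∂ν) = ∫ t, h t * fracTransform x θ (g t) ∂ν := by
  simp only [fracTransform]
  split_ifs with hs
  · rfl
  simp_rw [← integral_const_mul]
  have hgauss : Integrable fun y : ℝ => Real.exp (-(1 / 2) * y ^ 2) :=
    integrable_exp_neg_mul_sq (by norm_num)
  set c := ‖((1 + Complex.I * (Real.cot θ : ℂ)) / (2 * (Real.pi : ℂ))) ^ (1 / 2 : ℂ)‖ with hc
  have hdom : Integrable (fun p : X × ℝ =>
      c * (‖h p.1‖ * Real.exp (-(1 / 2) * (p.2 - m p.1) ^ 2))) (ν.prod volume) := by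
    refine Integrable.const_mul ?_ c
    rw [integrable_prod_iff]
    · refine ⟨.of_forall fun t => (hgauss.comp_sub_right (m t)).const_mul ‖h t‖, ?_⟩
      have : ∀ t, ∫ y, ‖‖h t‖ * Real.exp (-(1 / 2) * (y - m t) ^ 2)‖ =
          ‖h t‖ * ∫ y : ℝ, Real.exp (-(1 / 2) * y ^ 2) := fun t => by
        simp_rw [norm_mul, norm_norm, Real.norm_of_nonneg (Real.exp_pos _).le]
        rw [integral_const_mul,
          integral_sub_right_eq_self (fun y : ℝ => Real.exp (-(1 / 2) * y ^ 2))]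
      simp_rw [this]
      exact hh.norm.mul_const _
    · refine AEStronglyMeasurable.mul hh.1.norm.comp_fst ?_
      exact Measurable.aestronglyMeasurable (by fun_prop)
  have hint : Integrable (fun p : X × ℝ => fracKernel x p.2 θ * (h p.1 * g p.1 p.2))
      (ν.prod volume) := by
    refine hdom.mono' (AEStronglyMeasurable.mul ?_ (hh.1.comp_fst.mul hg.aestronglyMeasurable))
      (.of_forall fun p => ?_)
    · have : Continuous fun y => fracKernel x y θ := by
        unfold fracKernel
        fun_prop
      exact (this.measurable.comp measurable_snd).aestronglyMeasurable
    · rw [norm_mul, norm_mul, norm_fracKernel, ← hc]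
      gcongr
      exact hb _ _
  rw [integral_integral_swap (f := fun y t => fracKernel x y θ * (h t * g t y)) hint.swap]
  refine integral_congr_ae (.of_forall fun t => ?_)
  refine integral_congr_ae (.of_forall fun y => ?_)
  simp only
  ring

/-! ### The bifractional coherent states as Gaussians -/

/-- The state `exp (τ a†² / 2 + μ a†) |0⟩`. -/
def squeezedState {τ : ℂ} (hτ : ‖τ‖ < 1) (μ : ℂ) : HSpace := (memLp_squeezed hτ μ).toLp

theorem inner_displacement_vacuum {τ : ℂ} (hτ : ‖τ‖ < 1) (μ : ℂ) (u v : ℝ) :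
    inner ℂ (displacement u v (vacuum.toLp 2 (volume : Measure ℝ))) (squeezedState hτ μ) =
      Complex.exp (-((u : ℂ) ^ 2 + v ^ 2) / 2 + τ / 2 * (u - Complex.I * v) ^ 2
        + μ * (u - Complex.I * v)) := by
  have h : displacement u v (vacuum.toLp 2 (volume : Measure ℝ)) =
      (memLp_dispFun u v (vacuum.memLp 2)).toLp := displacement_toLp (vacuum.memLp 2) u v
  rw [h, inner_toLp]
  have e : ∀ᵐ x, squeezedState hτ μ x * conj (dispFun u v vacuum x) =
      ((Real.exp (-(u ^ 2 + v ^ 2) / 2) : ℝ) : ℂ) *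
        (squeezed τ μ x * conj (squeezed 0 (u + Complex.I * v) x)) := by
    filter_upwards [(memLp_squeezed hτ μ).coeFn_toLp] with x hx
    rw [squeezedState, hx, dispFun_vacuum, map_mul, Complex.conj_ofReal]
    ring
  rw [integral_congr_ae e, integral_const_mul, integral_squeezed_mul_conj hτ, Complex.ofReal_exp,
    ← Complex.exp_add]
  congr 1
  simp only [map_add, map_mul, Complex.conj_I, Complex.conj_ofReal]
  push_cast
  ring

theorem displacement_vacuum (u v : ℝ) :
    displacement u v (vacuum.toLp 2 (volume : Measure ℝ)) =
      Complex.exp (-((u : ℂ) ^ 2 + v ^ 2) / 2) •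
        squeezedState (τ := 0) (by simp) (u + Complex.I * v) := by
  have h : displacement u v (vacuum.toLp 2 (volume : Measure ℝ)) =
      (memLp_dispFun u v (vacuum.memLp 2)).toLp := displacement_toLp (vacuum.memLp 2) u v
  rw [h, squeezedState, ← MemLp.toLp_const_smul, MemLp.toLp_eq_toLp_iff]
  refine .of_forall fun x => ?_
  rw [dispFun_vacuum, Pi.smul_apply, smul_eq_mul]
  push_cast
  rfl

theorem vacuum_toLp : vacuum.toLp 2 (volume : Measure ℝ) =
    ((memLp_squeezed (τ := 0) (by simp) 0).toLp : HSpace) := by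
  refine (MemLp.toLp_eq_toLp_iff (vacuum.memLp 2) _).2 (.of_forall fun x => ?_)
  have := dispFun_vacuum 0 0 x
  rw [dispFun_zero] at this
  simpa using this

theorem lintegral_inner_displacement_squeezed {τ : ℂ} (hτ : ‖τ‖ < 1) (f : HSpace) :
    ∫⁻ p : ℝ × ℝ, ‖inner ℂ (displacement p.1 p.2 (squeezedState hτ 0)) f‖ₑ ^ 2 =
      ENNReal.ofReal (Real.pi * (√(1 - ‖τ‖ ^ 2))⁻¹) * ∫⁻ x, ‖f x‖ₑ ^ 2 := by
  rw [squeezedState, lintegral_inner_displacement (memLp_squeezed hτ 0) (continuous_squeezed τ 0)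
    (norm_squeezed_zero_le hτ), lintegral_squeezed_sq hτ, ENNReal.ofReal_mul Real.pi_pos.le]

theorem resolvesIdentity_vacuum : ResolvesIdentity (volume : Measure (ℝ × ℝ)) (1 / Real.pi)
    fun p => displacement p.1 p.2 (vacuum.toLp 2 (volume : Measure ℝ)) := by
  rw [vacuum_toLp]
  refine resolvesIdentity_of_lintegral Real.pi_pos (fun f =>
    (measurable_inner_displacement _ (continuous_squeezed 0 0) f).aestronglyMeasurable)
    fun f => ?_
  have := lintegral_inner_displacement_squeezed (τ := 0) (by simp) f
  simpa [squeezedState] using this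

/-- The squeezing parameter of the bifractional coherent states. -/
def tau (θ₁ θ₂ : ℝ) : ℂ :=
  ((Real.sin θ₂ ^ 2 - Real.sin θ₁ ^ 2 : ℝ) : ℂ) +
    ((Real.cos θ₁ * Real.sin θ₁ - Real.cos θ₂ * Real.sin θ₂ : ℝ) : ℂ) * Complex.I

/-- This is where cos(θ₁ - θ₂) ≠ 0 enters: it is equivalent to |τ| < 1, the normalisability of the
squeezed state. -/
theorem norm_tau_sq (θ₁ θ₂ : ℝ) : ‖tau θ₁ θ₂‖ ^ 2 = 1 - Real.cos (θ₁ - θ₂) ^ 2 := by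
  rw [Complex.sq_norm, tau, Complex.normSq_add_mul_I, Real.cos_sub]
  linear_combination (Real.sin θ₁ ^ 2 + Real.cos θ₂ ^ 2) * Real.sin_sq_add_cos_sq θ₁ +
    (Real.sin θ₂ ^ 2 - Real.sin θ₁ ^ 2 + 1) * Real.sin_sq_add_cos_sq θ₂

theorem norm_tau_lt {θ₁ θ₂ : ℝ} (hθ : Real.cos (θ₁ - θ₂) ≠ 0) : ‖tau θ₁ θ₂‖ < 1 := by
  have h := norm_tau_sq θ₁ θ₂
  have : 0 < Real.cos (θ₁ - θ₂) ^ 2 := by positivity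
  exact (sq_lt_one_iff₀ (norm_nonneg _)).1 (by linarith)

/-- The linear parameter of the bifractional coherent states. -/
def mu (α β θ₁ θ₂ : ℝ) : ℂ :=
  β * (Real.cos θ₂ + Complex.I * Real.sin θ₂)
    - Complex.I * α * (Real.cos θ₁ + Complex.I * Real.sin θ₁)

theorem exp_I_mul (θ : ℝ) :
    Complex.exp (Complex.I * θ) = Real.cos θ + Complex.I * Real.sin θ := by
  rw [mul_comm Complex.I, Complex.exp_mul_I, Complex.ofReal_cos, Complex.ofReal_sin, mul_comm]

theorem fracTransform_mul_gaussian (x θ : ℝ) (c k : ℂ) :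
    fracTransform x θ (fun y => Complex.exp (c + (-(y : ℂ) ^ 2 / 2 + k * y))) =
      Complex.exp (c + (-(x : ℂ) ^ 2 / 2 + (Real.cos θ + Complex.I * Real.sin θ) * k * x
        - Complex.I / 2 * (Real.cos θ + Complex.I * Real.sin θ) * Real.sin θ * k ^ 2)) := by
  simp_rw [Complex.exp_add c]
  rw [fracTransform_const_mul, fracTransform_gaussian, exp_I_mul]

theorem isBifracImage_vacuum (α β : ℝ) {θ₁ θ₂ : ℝ} (hθ : Real.cos (θ₁ - θ₂) ≠ 0) :
    IsBifracImage α β θ₁ θ₂ vacuum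
      ((((√|Real.cos (θ₁ - θ₂)| : ℝ) : ℂ) * Complex.exp (-((α : ℂ) ^ 2 + β ^ 2) / 2)) •
        squeezedState (norm_tau_lt hθ) (mu α β θ₁ θ₂)) := by
  intro φ
  have hI : Complex.I ^ 2 = -1 := Complex.I_sq
  have hφ := integrable_dispElem φ vacuum
  have hpi : (Real.pi : ℂ) ≠ 0 := by exact_mod_cast Real.pi_ne_zero
  let z : ℝ × ℝ → ℂ := fun p => p.1 - Complex.I * p.2
  let N : ℝ × ℝ → ℂ := fun p => -((p.1 : ℂ) ^ 2 + p.2 ^ 2) / 2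
  -- Inserting the coherent-state resolution leaves a and b only in an explicit Gaussian, while φ
  -- enters only through an integrable weight.
  have inner_eq : ∀ a b : ℝ, inner ℂ (φ.toLp 2 (volume : Measure ℝ) : HSpace)
      (displacement a (-b) (vacuum.toLp 2 (volume : Measure ℝ))) =
      (1 / Real.pi : ℝ) * ∫ p, dispElem φ vacuum p.1 p.2 *
        Complex.exp ((N p - (a : ℂ) ^ 2 / 2 + z p * a)
          + (-(b : ℂ) ^ 2 / 2 + (-Complex.I * z p) * b)) := fun a b => by
    rw [← (resolvesIdentity_vacuum _ _).2]
    congr 2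
    funext p
    rw [dispElem, displacement_vacuum a (-b), inner_smul_right, inner_displacement_vacuum,
      ← Complex.exp_add]
    congr 2
    simp only [z, N]
    push_cast
    ring
  have step1 : ∀ a : ℝ, (fracTransform α θ₁ fun b =>
      inner ℂ (φ.toLp 2 (volume : Measure ℝ) : HSpace)
        (displacement a (-b) (vacuum.toLp 2 (volume : Measure ℝ)))) =
      (1 / Real.pi : ℝ) * ∫ p, dispElem φ vacuum p.1 p.2 *
        Complex.exp ((N p - (α : ℂ) ^ 2 / 2
          - Complex.I * (Real.cos θ₁ + Complex.I * Real.sin θ₁) * z p * α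
          + Complex.I / 2 * (Real.cos θ₁ + Complex.I * Real.sin θ₁) * Real.sin θ₁ * z p ^ 2)
          + (-(a : ℂ) ^ 2 / 2 + z p * a)) := fun a => by
    simp_rw [inner_eq]
    rw [fracTransform_const_mul, fracTransform_integral α θ₁ hφ (m := fun p => -p.2)
      (g := fun p b => Complex.exp ((N p - (a : ℂ) ^ 2 / 2 + z p * a)
          + (-(b : ℂ) ^ 2 / 2 + (-Complex.I * z p) * b)))]
    · congr 2
      funext p
      rw [fracTransform_mul_gaussian]
      congr 2
      linear_combination (-Complex.I / 2 * (Real.cos θ₁ + Complex.I * Real.sin θ₁) * Real.sin θ₁ *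
        z p ^ 2) * hI
    · refine Continuous.measurable ?_
      simp only [Function.uncurry_def, N, z]
      fun_prop
    · fun_prop
    · intro p b
      rw [Complex.norm_exp, Real.exp_le_exp]
      have : ((N p - (a : ℂ) ^ 2 / 2 + z p * a)
          + (-(b : ℂ) ^ 2 / 2 + (-Complex.I * z p) * b)) =
          ((-(1 / 2) * (a - p.1) ^ 2 - 1 / 2 * (b + p.2) ^ 2 : ℝ) : ℂ)
            + ((-p.2 * a - p.1 * b : ℝ) : ℂ) * Complex.I := by
        simp only [N, z]
        push_cast
        linear_combination (p.2 * b : ℂ) * hI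
      rw [this]
      simp only [Complex.add_re, Complex.ofReal_re, Complex.re_ofReal_mul, Complex.I_re]
      nlinarith [sq_nonneg (a - p.1)]
  rw [bifracForm]
  simp_rw [step1]
  rw [fracTransform_const_mul, fracTransform_integral β θ₂ hφ (m := fun p => p.1)
    (g := fun p a => Complex.exp ((N p - (α : ℂ) ^ 2 / 2
          - Complex.I * (Real.cos θ₁ + Complex.I * Real.sin θ₁) * z p * α
          + Complex.I / 2 * (Real.cos θ₁ + Complex.I * Real.sin θ₁) * Real.sin θ₁ * z p ^ 2)
          + (-(a : ℂ) ^ 2 / 2 + z p * a)))]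
  · rw [inner_smul_right, mul_assoc]
    congr 1
    -- The squeezed side is expanded in the same coherent states, so it remains to match the
    -- Gaussian integrands pointwise.
    rw [← (resolvesIdentity_vacuum _ _).2, mul_left_comm, ← integral_const_mul]
    congr 2
    funext p
    rw [fracTransform_mul_gaussian, inner_displacement_vacuum, mul_left_comm, ← Complex.exp_add]
    congr 2
    simp only [N, z, mu, tau]
    push_cast
    linear_combination (-1 / 2 * (Complex.sin θ₁ ^ 2 - Complex.sin θ₂ ^ 2) *
      (p.1 - Complex.I * p.2) ^ 2) * hI
  · refine Continuous.measurable ?_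
    simp only [Function.uncurry_def, N, z]
    fun_prop
  · fun_prop
  · intro p a
    rw [Complex.norm_exp, Real.exp_le_exp]
    set s := Real.sin θ₁
    set c := Real.cos θ₁
    have hsc : s ^ 2 + c ^ 2 = 1 := Real.sin_sq_add_cos_sq θ₁
    -- The real part splits into two negative squares, since the first transform acts in modulus as
    -- a rotation of p by θ₁; the last real term vanishes by s² + c² = 1.
    have : ((N p - (α : ℂ) ^ 2 / 2 - Complex.I * (c + Complex.I * s) * z p * α
          + Complex.I / 2 * (c + Complex.I * s) * s * z p ^ 2)
          + (-(a : ℂ) ^ 2 / 2 + z p * a)) =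
        ((-(1 / 2) * (a - p.1) ^ 2 - 1 / 2 * (α - (s * p.1 - c * p.2)) ^ 2
          - p.2 ^ 2 / 2 * (1 - s ^ 2 - c ^ 2) : ℝ) : ℂ)
        + ((-p.2 * a - α * (c * p.1 + s * p.2)
          + s / 2 * (c * (p.1 ^ 2 - p.2 ^ 2) + 2 * s * p.1 * p.2) : ℝ) : ℂ) * Complex.I := by
      simp only [N, z]
      push_cast
      linear_combination (α * (c * p.2 - s * p.1 + Complex.I * s * p.2) + s / 2 *
        (-2 * c * p.1 * p.2 + Complex.I * c * p.2 ^ 2 + s * p.1 ^ 2 - 2 * Complex.I * s * p.1 * p.2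
          + s * p.2 ^ 2 * (Complex.I ^ 2 - 1))) * hI
    rw [this]
    simp only [Complex.add_re, Complex.ofReal_re, Complex.re_ofReal_mul, Complex.I_re]
    nlinarith [sq_nonneg (α - (s * p.1 - c * p.2))]

theorem ket_eq (α β : ℝ) {θ₁ θ₂ : ℝ} (hθ : Real.cos (θ₁ - θ₂) ≠ 0) :
    ket α β θ₁ θ₂ =
      (((√|Real.cos (θ₁ - θ₂)| : ℝ) : ℂ) * Complex.exp (-((α : ℂ) ^ 2 + β ^ 2) / 2)) •
        squeezedState (norm_tau_lt hθ) (mu α β θ₁ θ₂) := by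
  have h := isBifracImage_vacuum α β hθ
  have hex : ∃ χ, IsBifracImage α β θ₁ θ₂ vacuum χ := ⟨_, h⟩
  rw [ket, bifracOp, dif_pos hex]
  exact hex.choose_spec.unique h

/-! ### Analyticity -/

theorem bParam_eq (θ₁ θ₂ : ℝ) : bParam θ₁ θ₂ = conj (tau θ₁ θ₂) / 2 := by
  have h : ∀ θ : ℝ, Complex.exp (-2 * Complex.I * θ) =
      (Real.cos θ - Complex.I * Real.sin θ) ^ 2 := fun θ => by
    have : -2 * Complex.I * θ = (2 : ℕ) * (Complex.I * ((-θ : ℝ) : ℂ)) := by push_cast; ring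
    rw [this, Complex.exp_nat_mul, exp_I_mul, Real.cos_neg, Real.sin_neg]
    push_cast
    ring
  have h1 : ∀ θ : ℝ, (Real.sin θ : ℂ) ^ 2 + (Real.cos θ : ℂ) ^ 2 = 1 := fun θ => by
    exact_mod_cast Real.sin_sq_add_cos_sq θ
  rw [bParam, h, h, tau, map_add, map_mul, Complex.conj_ofReal, Complex.conj_ofReal, Complex.conj_I]
  have a := h1 θ₁
  have b := h1 θ₂
  push_cast at a b ⊢
  linear_combination (a - b) / 4 +
    ((Complex.sin θ₁ : ℂ) ^ 2 - (Complex.sin θ₂ : ℂ) ^ 2) / 4 * Complex.I_sq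

theorem conj_phase_mul_re (θ : ℝ) (w : ℂ) :
    (conj (phase θ) * w).re = Real.sin θ * w.re + Real.cos θ * w.im := by
  rw [phase_eq]
  simp

theorem conj_phase_mul_im (θ : ℝ) (w : ℂ) :
    (conj (phase θ) * w).im = Real.sin θ * w.im - Real.cos θ * w.re := by
  rw [phase_eq]
  simp [sub_eq_add_neg]

/-- The first term is (α² + β²)/2 in the coordinates of w, which cancels the Gaussian factor of the
coherent state; what remains is holomorphic. -/
theorem expoE_eq (θ₁ θ₂ : ℝ) (w : ℂ) :
    expoE θ₁ θ₂ w = (((conj (phase θ₁) * w).re : ℂ) ^ 2 + ((conj (phase θ₂) * w).im : ℂ) ^ 2) / 2 +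
      tau θ₁ θ₂ / 4 * w ^ 2 := by
  have h1 : ∀ θ : ℝ, (Real.sin θ : ℂ) ^ 2 + (Real.cos θ : ℂ) ^ 2 = 1 := fun θ => by
    exact_mod_cast Real.sin_sq_add_cos_sq θ
  have a := h1 θ₁
  have b := h1 θ₂
  have hw : w = w.re + w.im * Complex.I := (Complex.re_add_im w).symm
  have hw' : conj w = w.re - w.im * Complex.I := by
    apply Complex.ext <;> simp
  have hn : ((‖w‖ ^ 2 : ℝ) : ℂ) = (w.re : ℂ) ^ 2 + (w.im : ℂ) ^ 2 := by
    rw [Complex.sq_norm, Complex.normSq_apply]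
    push_cast
    ring
  rw [expoE, bParam_eq, conj_phase_mul_re, conj_phase_mul_im, hn, hw', tau]
  simp only [map_add, map_mul, Complex.conj_ofReal, Complex.conj_I]
  clear hw' hn
  generalize w.re = X at *
  generalize w.im = Y at *
  rw [hw]
  generalize Real.sin θ₁ = s₁ at *
  generalize Real.sin θ₂ = s₂ at *
  generalize Real.cos θ₁ = c₁ at *
  generalize Real.cos θ₂ = c₂ at *
  push_cast
  have hI := Complex.I_sq
  clear h1
  grind

/-- Shows that w is the right complex coordinate: the real-linear parameter μ is complex-linear in
it. -/
theorem mu_eq (θ₁ θ₂ : ℝ) (w : ℂ) :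
    mu (conj (phase θ₁) * w).re (conj (phase θ₂) * w).im θ₁ θ₂ =
      -(Real.cos (θ₁ - θ₂) * (Real.cos θ₁ + Complex.I * Real.sin θ₁) *
        (Real.cos θ₂ + Complex.I * Real.sin θ₂)) * w := by
  have h1 : ∀ θ : ℝ, (Real.sin θ : ℂ) ^ 2 + (Real.cos θ : ℂ) ^ 2 = 1 := fun θ => by
    exact_mod_cast Real.sin_sq_add_cos_sq θ
  have a := h1 θ₁
  have b := h1 θ₂
  have hw : w = w.re + w.im * Complex.I := (Complex.re_add_im w).symm
  rw [mu, conj_phase_mul_re, conj_phase_mul_im, Real.cos_sub]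
  conv_rhs => rw [hw]
  generalize w.re = X at *
  generalize w.im = Y at *
  generalize Real.sin θ₁ = s₁ at *
  generalize Real.sin θ₂ = s₂ at *
  generalize Real.cos θ₁ = c₁ at *
  generalize Real.cos θ₂ = c₂ at *
  push_cast
  have hI := Complex.I_sq
  clear h1
  grind

theorem exists_differentiable_wState {θ₁ θ₂ : ℝ} (hθ : Real.cos (θ₁ - θ₂) ≠ 0) :
    ∃ F : ℂ → HSpace, Differentiable ℂ F ∧
      ∀ w, Complex.exp (expoE θ₁ θ₂ w) • wState θ₁ θ₂ w = F w := by
  set k : ℂ := -(Real.cos (θ₁ - θ₂) * (Real.cos θ₁ + Complex.I * Real.sin θ₁) *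
        (Real.cos θ₂ + Complex.I * Real.sin θ₂)) with hk
  refine ⟨fun w => (((√|Real.cos (θ₁ - θ₂)| : ℝ) : ℂ) *
    Complex.exp (tau θ₁ θ₂ / 4 * w ^ 2)) • squeezedState (norm_tau_lt hθ) (k * w), ?_, fun w => ?_⟩
  · have h1 : Differentiable ℂ fun w : ℂ => k * w := by fun_prop
    have h2 : Differentiable ℂ fun w : ℂ => ((√|Real.cos (θ₁ - θ₂)| : ℝ) : ℂ) *
      Complex.exp (tau θ₁ θ₂ / 4 * w ^ 2) := by fun_prop
    exact h2.smul ((differentiable_toLp_squeezed (norm_tau_lt hθ)).comp h1)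
  · rw [wState, ket_eq _ _ hθ, smul_smul, mu_eq, ← hk, mul_left_comm, ← Complex.exp_add, expoE_eq]
    congr 3
    ring

/-! ### Resolution of the identity -/

theorem lintegral_comp_linear (a b c d : ℝ) (h : a * d - b * c ≠ 0) {F : ℝ × ℝ → ℝ≥0∞}
    (hF : Measurable F) : ∫⁻ p : ℝ × ℝ, F (a * p.1 + b * p.2, c * p.1 + d * p.2) =
      ENNReal.ofReal |a * d - b * c|⁻¹ * ∫⁻ p, F p := by
  set L := Matrix.toLin (Module.Basis.finTwoProd ℝ) (Module.Basis.finTwoProd ℝ) !![a, b; c, d]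
    with hL
  have hdet : LinearMap.det L = a * d - b * c := by
    rw [hL, LinearMap.det_toLin, Matrix.det_fin_two_of]
  have hLa : ∀ p : ℝ × ℝ, L p = (a * p.1 + b * p.2, c * p.1 + d * p.2) := fun p => by
    rw [hL, Matrix.toLin_finTwoProd_apply]
  have hm := Measure.map_linearMap_addHaar_eq_smul_addHaar (volume : Measure (ℝ × ℝ)) (f := L)
    (by rwa [hdet])
  have := lintegral_map (μ := (volume : Measure (ℝ × ℝ))) hF
    L.continuous_of_finiteDimensional.measurable
  rw [hm, lintegral_smul_measure, hdet, abs_inv, smul_eq_mul] at this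
  simp_rw [hLa] at this
  exact this.symm

/-- The scalar relating a bifractional coherent state to a displaced squeezed vacuum. -/
def dispScalar (θ₁ θ₂ u v : ℝ) : ℂ :=
  ((√|Real.cos (θ₁ - θ₂)| : ℝ) : ℂ) *
    Complex.exp (-(((Real.sin θ₁ * u - Real.cos θ₁ * v : ℝ) : ℂ) ^ 2 +
      ((Real.cos θ₂ * u + Real.sin θ₂ * v : ℝ) : ℂ) ^ 2) / 2 +
        (((u : ℂ) ^ 2 + v ^ 2) / 2 - tau θ₁ θ₂ / 2 * (u - Complex.I * v) ^ 2))

/-- This substitution brings μ to the form z - τz̄, z = u + iv, which is the linear parameter of a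
displaced squeezed vacuum. The point z is in general not w. -/
theorem mu_disp (θ₁ θ₂ u v : ℝ) :
    mu (Real.sin θ₁ * u - Real.cos θ₁ * v) (Real.cos θ₂ * u + Real.sin θ₂ * v) θ₁ θ₂ =
      (u + Complex.I * v) - tau θ₁ θ₂ * (u - Complex.I * v) := by
  have h1 : ∀ θ : ℝ, (Real.sin θ : ℂ) ^ 2 + (Real.cos θ : ℂ) ^ 2 = 1 := fun θ => by
    exact_mod_cast Real.sin_sq_add_cos_sq θ
  have a := h1 θ₁
  have b := h1 θ₂
  rw [mu, tau]
  generalize Real.sin θ₁ = s₁ at *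
  generalize Real.sin θ₂ = s₂ at *
  generalize Real.cos θ₁ = c₁ at *
  generalize Real.cos θ₂ = c₂ at *
  push_cast
  have hI := Complex.I_sq
  clear h1
  grind

theorem ket_eq_displacement {θ₁ θ₂ : ℝ} (hθ : Real.cos (θ₁ - θ₂) ≠ 0) (u v : ℝ) :
    ket (Real.sin θ₁ * u - Real.cos θ₁ * v) (Real.cos θ₂ * u + Real.sin θ₂ * v) θ₁ θ₂ =
      dispScalar θ₁ θ₂ u v • displacement u v (squeezedState (norm_tau_lt hθ) 0) := by
  rw [ket_eq _ _ hθ, mu_disp, squeezedState, squeezedState, displacement_toLp,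
    ← MemLp.toLp_const_smul, ← MemLp.toLp_const_smul, MemLp.toLp_eq_toLp_iff]
  refine .of_forall fun x => ?_
  simp only [Pi.smul_apply, smul_eq_mul]
  rw [squeezed_sub_mul_conj (norm_tau_lt hθ), dispScalar, Complex.exp_add]
  ring

/-- The exponent is purely imaginary: α² + β² equals |z|² - Re(τz̄²) in the new variables. -/
theorem norm_dispScalar (θ₁ θ₂ u v : ℝ) :
    ‖dispScalar θ₁ θ₂ u v‖ = √|Real.cos (θ₁ - θ₂)| := by
  have a := Real.sin_sq_add_cos_sq θ₁
  have b := Real.sin_sq_add_cos_sq θ₂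
  have e : -(((Real.sin θ₁ * u - Real.cos θ₁ * v : ℝ) : ℂ) ^ 2 +
      ((Real.cos θ₂ * u + Real.sin θ₂ * v : ℝ) : ℂ) ^ 2) / 2 +
        (((u : ℂ) ^ 2 + v ^ 2) / 2 - tau θ₁ θ₂ / 2 * (u - Complex.I * v) ^ 2) =
      ((-((Real.cos θ₁ * Real.sin θ₁ - Real.cos θ₂ * Real.sin θ₂) * (u ^ 2 - v ^ 2)
        - 2 * (Real.sin θ₂ ^ 2 - Real.sin θ₁ ^ 2) * u * v) / 2 : ℝ) : ℂ) * Complex.I := by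
    have a' : (Real.sin θ₁ : ℂ) ^ 2 + (Real.cos θ₁ : ℂ) ^ 2 = 1 := by exact_mod_cast a
    have b' : (Real.sin θ₂ : ℂ) ^ 2 + (Real.cos θ₂ : ℂ) ^ 2 = 1 := by exact_mod_cast b
    have hI := Complex.I_sq
    rw [tau]
    clear a b
    generalize Real.sin θ₁ = s₁ at *
    generalize Real.sin θ₂ = s₂ at *
    generalize Real.cos θ₁ = c₁ at *
    generalize Real.cos θ₂ = c₂ at *
    push_cast
    grind
  rw [dispScalar, norm_mul, Complex.norm_real, Real.norm_of_nonneg (Real.sqrt_nonneg _), e,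
    Complex.norm_exp_ofReal_mul_I, mul_one]

theorem measurable_inner_ket {θ₁ θ₂ : ℝ} (hθ : Real.cos (θ₁ - θ₂) ≠ 0) (f : HSpace) :
    StronglyMeasurable fun p : ℝ × ℝ => inner ℂ (ket p.1 p.2 θ₁ θ₂) f := by
  set c := Real.cos (θ₁ - θ₂) with hc
  have h1 : StronglyMeasurable fun p : ℝ × ℝ => conj (dispScalar θ₁ θ₂ p.1 p.2) *
      inner ℂ (displacement p.1 p.2 (squeezedState (norm_tau_lt hθ) 0)) f := by
    refine StronglyMeasurable.mul (Continuous.stronglyMeasurable ?_)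
      (measurable_inner_displacement _ (continuous_squeezed _ 0) f)
    simp only [dispScalar]
    fun_prop
  -- The inverse of (u, v) ↦ (α, β), whose determinant is cos(θ₁ - θ₂).
  have h2 : Measurable fun p : ℝ × ℝ => ((p.2 * Real.cos θ₁ + p.1 * Real.sin θ₂) / c,
      (p.2 * Real.sin θ₁ - p.1 * Real.cos θ₂) / c) := by fun_prop
  convert h1.comp_measurable h2 using 2 with p
  rw [Function.comp_apply, ← inner_smul_left, ← ket_eq_displacement hθ]
  have e : c = Real.cos θ₁ * Real.cos θ₂ + Real.sin θ₁ * Real.sin θ₂ := Real.cos_sub _ _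
  congr 2
  · field_simp
    rw [e]
    ring
  · field_simp
    rw [e]
    ring

/-- The Jacobian and the squared scalar each contribute |cos(θ₁ - θ₂)|, and the squared norm of the
squeezed vacuum contributes its inverse, so one factor survives. -/
theorem lintegral_inner_ket {θ₁ θ₂ : ℝ} (hθ : Real.cos (θ₁ - θ₂) ≠ 0) (f : HSpace) :
    ∫⁻ p : ℝ × ℝ, ‖inner ℂ (ket p.1 p.2 θ₁ θ₂) f‖ₑ ^ 2 =
      ENNReal.ofReal (Real.pi * |Real.cos (θ₁ - θ₂)|) * ∫⁻ x, ‖f x‖ₑ ^ 2 := by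
  have e : Real.sin θ₁ * Real.sin θ₂ - -Real.cos θ₁ * Real.cos θ₂ = Real.cos (θ₁ - θ₂) := by
    rw [Real.cos_sub]; ring
  have hpos : 0 < |Real.cos (θ₁ - θ₂)| := abs_pos.2 hθ
  have h1 := lintegral_comp_linear (Real.sin θ₁) (-Real.cos θ₁) (Real.cos θ₂) (Real.sin θ₂)
    (by rwa [e]) (F := fun p => ‖inner ℂ (ket p.1 p.2 θ₁ θ₂) f‖ₑ ^ 2)
    ((measurable_inner_ket hθ f).enorm.pow_const 2)
  have h2 : ∀ p : ℝ × ℝ, ‖inner ℂ (ket (Real.sin θ₁ * p.1 + -Real.cos θ₁ * p.2)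
      (Real.cos θ₂ * p.1 + Real.sin θ₂ * p.2) θ₁ θ₂) f‖ₑ ^ 2 =
      ENNReal.ofReal |Real.cos (θ₁ - θ₂)| *
        ‖inner ℂ (displacement p.1 p.2 (squeezedState (norm_tau_lt hθ) 0)) f‖ₑ ^ 2 := fun p => by
    rw [neg_mul, ← sub_eq_add_neg, ket_eq_displacement hθ, inner_smul_left, enorm_mul, mul_pow,
      ← ofReal_norm (conj _), RCLike.norm_conj, norm_dispScalar,
      ← ENNReal.ofReal_pow (Real.sqrt_nonneg _), Real.sq_sqrt hpos.le]
  have h3 : √(1 - ‖tau θ₁ θ₂‖ ^ 2) = |Real.cos (θ₁ - θ₂)| := by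
    rw [norm_tau_sq, sub_sub_cancel, Real.sqrt_sq_eq_abs]
  simp only [h2, e] at h1
  rw [lintegral_const_mul' _ _ ENNReal.ofReal_ne_top, lintegral_inner_displacement_squeezed, h3,
    ← mul_assoc, ← ENNReal.ofReal_mul hpos.le] at h1
  have h4 : ENNReal.ofReal |Real.cos (θ₁ - θ₂)| * ENNReal.ofReal |Real.cos (θ₁ - θ₂)|⁻¹ = 1 := by
    rw [← ENNReal.ofReal_mul hpos.le, mul_inv_cancel₀ hpos.ne', ENNReal.ofReal_one]
  rw [← one_mul (∫⁻ p : ℝ × ℝ, _), ← h4, mul_assoc, ← h1, ← mul_assoc,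
    ← ENNReal.ofReal_mul hpos.le]
  congr 2
  field_simp

theorem resolvesIdentity_ket {θ₁ θ₂ : ℝ} (hθ : Real.cos (θ₁ - θ₂) ≠ 0) :
    ResolvesIdentity (volume : Measure (ℝ × ℝ)) (1 / (Real.pi * |Real.cos (θ₁ - θ₂)|))
      (fun p => ket p.1 p.2 θ₁ θ₂) :=
  resolvesIdentity_of_lintegral (mul_pos Real.pi_pos (abs_pos.2 hθ))
    (fun f => (measurable_inner_ket hθ f).aestronglyMeasurable) (lintegral_inner_ket hθ)

/-- The linear map w ↦ (α, β) also has determinant cos(θ₁ - θ₂), which absorbs the remaining factor.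
-/
theorem resolvesIdentity_wState {θ₁ θ₂ : ℝ} (hθ : Real.cos (θ₁ - θ₂) ≠ 0) :
    ResolvesIdentity (volume : Measure ℂ) (1 / Real.pi) (wState θ₁ θ₂) := by
  have e : Real.sin θ₁ * Real.sin θ₂ - Real.cos θ₁ * -Real.cos θ₂ = Real.cos (θ₁ - θ₂) := by
    rw [Real.cos_sub]; ring
  have hpos : 0 < |Real.cos (θ₁ - θ₂)| := abs_pos.2 hθ
  have hw : ∀ w, wState θ₁ θ₂ w = (fun p : ℝ × ℝ =>
      ket (Real.sin θ₁ * p.1 + Real.cos θ₁ * p.2) (-Real.cos θ₂ * p.1 + Real.sin θ₂ * p.2) θ₁ θ₂)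
        (Complex.measurableEquivRealProd w) := fun w => by
    rw [wState, conj_phase_mul_re, conj_phase_mul_im, Complex.measurableEquivRealProd_apply]
    congr 1
    ring
  refine resolvesIdentity_of_lintegral Real.pi_pos (fun f => ?_) fun f => ?_
  · simp only [wState]
    have h2 : Measurable fun w : ℂ => ((conj (phase θ₁) * w).re, (conj (phase θ₂) * w).im) := by
      fun_prop
    exact ((measurable_inner_ket hθ f).comp_measurable h2).aestronglyMeasurable
  · simp_rw [hw]
    rw [Complex.volume_preserving_equiv_real_prod.lintegral_comp_emb
      (MeasurableEquiv.measurableEmbedding _) (fun p : ℝ × ℝ => ‖inner ℂ (ket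
        (Real.sin θ₁ * p.1 + Real.cos θ₁ * p.2) (-Real.cos θ₂ * p.1 + Real.sin θ₂ * p.2) θ₁ θ₂)
          f‖ₑ ^ 2),
      lintegral_comp_linear (Real.sin θ₁) (Real.cos θ₁) (-Real.cos θ₂) (Real.sin θ₂)
      (by rwa [e]) (F := fun p => ‖inner ℂ (ket p.1 p.2 θ₁ θ₂) f‖ₑ ^ 2)
      ((measurable_inner_ket hθ f).enorm.pow_const 2), e, lintegral_inner_ket hθ, ← mul_assoc,
      ← ENNReal.ofReal_mul (by positivity)]
    congr 2
    field_simp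

end Bifractional

end

theorem mainTheorem2 (θ₁ θ₂ : ℝ) (hθ : Real.cos (θ₁ - θ₂) ≠ 0) :
    (∃ F : ℂ → Bifractional.HSpace, Differentiable ℂ F ∧
      ∀ α β : ℝ,
        Complex.exp (Bifractional.expoE θ₁ θ₂ (Bifractional.wParam α β θ₁ θ₂)) •
            Bifractional.ket α β θ₁ θ₂ =
          F (Bifractional.wParam α β θ₁ θ₂)) ∧
    Bifractional.ResolvesIdentity (volume : Measure (ℝ × ℝ))
      (1 / (Real.pi * |Real.cos (θ₁ - θ₂)|))
      (fun p => Bifractional.ket p.1 p.2 θ₁ θ₂) ∧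
    Bifractional.ResolvesIdentity (volume : Measure ℂ) (1 / Real.pi)
      (Bifractional.wState θ₁ θ₂) := by
  refine ⟨?_, Bifractional.resolvesIdentity_ket hθ, Bifractional.resolvesIdentity_wState hθ⟩
  obtain ⟨F, hF, h⟩ := Bifractional.exists_differentiable_wState hθ
  refine ⟨F, hF, fun α β => ?_⟩
  rw [← h, Bifractional.wState_wParam α β θ₁ θ₂ hθ]
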